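/- All rings are associative and unital, not necessarily commutative. Let $S\to R$ be a ring extension, i.e. a (unital, not necessarily injective) ring homomorphism. An \emph{$S$-relative differential graded ring} is an $\mathbb N$-graded ring $\Omega=\bigoplus_{n\ge 0}\Omega^n$ with an additive map $d:\Omega^{\bullet}\to\Omega^{\bullet+1}$ such that $d\circ d=0$ and $d(\omega\omega')=d(\omega)\omega'+(-1)^n\omega\, d(\omega')$ for $\omega\in\Omega^n$, $\omega'\in\Omega$, together with a ring map $S\to\Omega^0$ such that $d$ vanishes on the image of $S$ (so that $d$ is an $(S,S)$-bimodule map). Isomorphisms are isomorphisms of graded rings commuting with $d$ and with the maps from $S$. Let ${\mathfrak C}=R\otimes_S R$ be the canonical Sweedler $R$-coring, with coproduct $\Delta(r\otimes_S r')=(r\otimes_S 1_R)\otimes_R(1_R\otimes_S r')$ and counit $\epsilon(r\otimes_S r')=rr'$, and let $g=1_R\otimes_S 1_R$. Let $\Omega({\mathfrak C}/S)$ be the ring of ${\mathfrak C}$-valued differential forms on $R$: it is the tensor ring of the $(R,R)$-bimodule $\ker\epsilon$, so $\Omega^0({\mathfrak C}/S)=R$ and $\Omega^n({\mathfrak C}/S)=(\ker\epsilon)^{\otimes_R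 n}$, and its differential is the restriction of the Amitsur differential of the tensor ring of ${\mathfrak C}$, given by $d(r)=gr-rg$ and $$d(c^1\otimes_R\cdots\otimes_R c^n)=g\otimes_R c^1\otimes_R\cdots\otimes_R c^n+\sum_{i=1}^n(-1)^i c^1\otimes_R\cdots\otimes_R\Delta(c^i)\otimes_R\cdots\otimes_R c^n+(-1)^{n+1}c^1\otimes_R\cdots\otimes_R c^n\otimes_R g .$$ Let $\pi:R\to R/S$ be the cokernel of $S\to R$, an $(S,S)$-bimodule map, and let $\Omega_SR$ be the (Cuntz--Quillen) algebra of $S$-relative differential forms: $\Omega^n_SR=R\otimes_S(R/S)^{\otimes_S n}$, and, writing $(r_0,r_1,\ldots,r_n)=r_0\otimes_S\pi(r_1)\otimes_S\cdots\otimes_S\pi(r_n)$ for $r_i\in R$, $$(r_0,\ldots,r_n)(r_{n+1},\ldots,r_m)=\sum_{i=0}^n(-1)^{n-i}(r_0,\ldots,r_{i-1},r_ir_{i+1},r_{i+2},\ldots,r_m),\qquad d(r_0,\ldots,r_n)=(1_R,r_0,\ldots,r_n).$$ In both cases $S$ maps to the degree-zero component $R$ by the given map $S\to R$. Then $\Omega({\mathfrak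 C}/S)$ and $\Omega_SR$ are isomorphic as $S$-relative differential graded rings. -/

import Mathlib

open MulOpposite (op)

noncomputable section

namespace CoringForms

universe u v w

open scoped DirectSum

/-! ### Tensor products over a noncommutative ring -/

section Tensor

open scoped TensorProduct

/-- The tensor product `M ⊗_R N` of a right module and a left module over a ring `R`:
the quotient of `M ⊗_ℤ N` by the relations `m r ⊗ n = m ⊗ r n`. Right `R`-modules are
modules over `Rᵐᵒᵖ`, the product `m r` being `op r • m`. -/
def BalTensor (R : Type*) (M N : Type*) [Ring R] [AddCommGroup M] [Module Rᵐᵒᵖ M]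
    [AddCommGroup N] [Module R N] : Type _ :=
  (M ⊗[ℤ] N) ⧸ (Submodule.span ℤ
    {z : M ⊗[ℤ] N | ∃ (m : M) (r : R) (n : N), z = (op r • m) ⊗ₜ[ℤ] n - m ⊗ₜ[ℤ] (r • n)})

variable {R : Type*} {M N P : Type*} [Ring R] [AddCommGroup M] [Module Rᵐᵒᵖ M]
    [AddCommGroup N] [Module R N] [AddCommGroup P]

instance BalTensor.instAddCommGroup : AddCommGroup (BalTensor R M N) := by
  unfold BalTensor; infer_instance

namespace BalTensor

/-- The class of `m ⊗ n` in `M ⊗_R N`, as a biadditive map. -/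
def mk (R : Type*) {M N : Type*} [Ring R] [AddCommGroup M] [Module Rᵐᵒᵖ M]
    [AddCommGroup N] [Module R N] : M →+ N →+ BalTensor R M N :=
  AddMonoidHom.mk' (fun m => AddMonoidHom.mk' (fun n => Submodule.Quotient.mk (m ⊗ₜ[ℤ] n))
    (fun a b => by rw [TensorProduct.tmul_add]; rfl))
    (fun a b => by ext n; simp only [TensorProduct.add_tmul]; rfl)

theorem mk_smul (m : M) (r : R) (n : N) : mk R (op r • m) n = mk R m (r • n) :=
  (Submodule.Quotient.eq _).2 (Submodule.subset_span ⟨m, r, n, rfl⟩)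

/-- The universal property: a balanced biadditive map factors through `M ⊗_R N`. -/
def lift (f : M →+ N →+ P) (hf : ∀ m (r : R) n, f (op r • m) n = f m (r • n)) :
    BalTensor R M N →+ P :=
  (Submodule.liftQ _ (TensorProduct.liftAddHom (R := ℤ) f
      (fun r m n => by simp only [map_zsmul, AddMonoidHom.zsmul_apply])).toIntLinearMap (by
    rw [Submodule.span_le]
    rintro _ ⟨m, r, n, rfl⟩
    simp [hf])).toAddMonoidHom

@[simp] theorem lift_mk (f : M →+ N →+ P) (hf : ∀ m (r : R) n, f (op r • m) n = f m (r • n))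
    (m : M) (n : N) : lift f hf (mk R m n) = f m n := rfl

@[elab_as_elim]
theorem induction {p : BalTensor R M N → Prop} (z : BalTensor R M N)
    (tmul : ∀ m n, p (mk R m n)) (add : ∀ x y, p x → p y → p (x + y)) : p z := by
  obtain ⟨z, rfl⟩ := Submodule.Quotient.mk_surjective _ z
  induction z using TensorProduct.induction_on with
  | zero =>
    have h := tmul 0 0
    rw [map_zero] at h
    exact h
  | tmul m n => exact tmul m n
  | add x y hx hy => exact add _ _ hx hy

theorem hom_ext {f g : BalTensor R M N →+ P} (h : ∀ m n, f (mk R m n) = g (mk R m n)) :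
    f = g := by
  ext z
  induction z using induction with
  | tmul m n => exact h m n
  | add x y hx hy => rw [map_add, map_add, hx, hy]

/-- The map `f ⊗ g` induced by a right linear map `f` and a left linear map `g`. -/
def map {M' N' : Type*} [AddCommGroup M'] [Module Rᵐᵒᵖ M'] [AddCommGroup N'] [Module R N']
    (f : M →+ M') (hf : ∀ (r : R) m, f (op r • m) = op r • f m)
    (g : N →+ N') (hg : ∀ (r : R) n, g (r • n) = r • g n) :
    BalTensor R M N →+ BalTensor R M' N' :=
  lift (((mk R).compl₂ g).comp f) (fun m r n => by simp [hf, hg, mk_smul])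

@[simp] theorem map_mk {M' N' : Type*} [AddCommGroup M'] [Module Rᵐᵒᵖ M'] [AddCommGroup N']
    [Module R N'] (f : M →+ M') (hf : ∀ (r : R) m, f (op r • m) = op r • f m)
    (g : N →+ N') (hg : ∀ (r : R) n, g (r • n) = r • g n) (m : M) (n : N) :
    map f hf g hg (mk R m n) = mk R (f m) (g n) := rfl

end BalTensor

end Tensor

/-! ### Bimodules -/

/-- An `(A, B)`-bimodule. -/
structure Bimod (A : Type u) (B : Type v) [Ring A] [Ring B] where
  carrier : Type w
  [addCommGroup : AddCommGroup carrier]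
  [left : Module A carrier]
  [right : Module Bᵐᵒᵖ carrier]
  [comm : SMulCommClass A Bᵐᵒᵖ carrier]

attribute [instance] Bimod.addCommGroup Bimod.left Bimod.right Bimod.comm

instance {A : Type u} {B : Type v} [Ring A] [Ring B] :
    CoeSort (Bimod.{u, v, w} A B) (Type w) := ⟨Bimod.carrier⟩

/-- A homomorphism of bimodules. -/
structure BimodHom {A B : Type*} [Ring A] [Ring B] (X Y : Bimod A B) extends X →+ Y where
  map_left : ∀ (a : A) (x : X), toFun (a • x) = a • toFun x
  map_right : ∀ (b : B) (x : X), toFun (op b • x) = op b • toFun x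

instance {A B : Type*} [Ring A] [Ring B] (X Y : Bimod A B) : FunLike (BimodHom X Y) X Y where
  coe f := f.toFun
  coe_injective f g h := by
    cases f; cases g; congr; exact DFunLike.coe_injective h

instance {A B : Type*} [Ring A] [Ring B] (X Y : Bimod A B) :
    AddMonoidHomClass (BimodHom X Y) X Y where
  map_add f := f.map_add'
  map_zero f := f.map_zero'

section

variable {A B : Type*} [Ring A] [Ring B] {X Y : Bimod A B}

theorem BimodHom.left (f : BimodHom X Y) (a : A) (x : X) : f (a • x) = a • f x := f.map_left a x

theorem BimodHom.right (f : BimodHom X Y) (b : B) (x : X) : f (op b • x) = op b • f x :=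
  f.map_right b x

@[simp] theorem BimodHom.toAddMonoidHom_apply (f : BimodHom X Y) (x : X) :
    f.toAddMonoidHom x = f x := rfl

end

namespace Bimod

variable {A B R : Type*} [Ring A] [Ring B] [Ring R]

/-- The ring `R` as an `(R, R)`-bimodule. -/
def regular (R : Type u) [Ring R] : Bimod.{u, u, u} R R where
  carrier := R

/-- Multiplication by a scalar from the left on the tensor product of bimodules. -/
def smulLeft (X : Bimod A R) (Y : Bimod R B) (a : A) : BalTensor R X Y →+ BalTensor R X Y :=
  BalTensor.map (DistribSMul.toAddMonoidHom X a) (fun r m => smul_comm a (op r) m)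
    (AddMonoidHom.id Y) (fun _ _ => rfl)

/-- Multiplication by a scalar from the right on the tensor product of bimodules. -/
def smulRight (X : Bimod A R) (Y : Bimod R B) (b : Bᵐᵒᵖ) :
    BalTensor R X Y →+ BalTensor R X Y :=
  BalTensor.map (AddMonoidHom.id X) (fun _ _ => rfl)
    (DistribSMul.toAddMonoidHom Y b) (fun r m => (smul_comm r b m).symm)

theorem smulLeft_mk (X : Bimod A R) (Y : Bimod R B) (a : A) (m : X) (n : Y) :
    smulLeft X Y a (BalTensor.mk R m n) = BalTensor.mk R (a • m) n := rfl

theorem smulRight_mk (X : Bimod A R) (Y : Bimod R B) (b : Bᵐᵒᵖ) (m : X) (n : Y) :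
    smulRight X Y b (BalTensor.mk R m n) = BalTensor.mk R m (b • n) := rfl

/-- The tensor product of an `(A, R)`-bimodule and an `(R, B)`-bimodule, an `(A, B)`-bimodule. -/
def tensor (X : Bimod A R) (Y : Bimod R B) : Bimod A B :=
  letI l : Module A (BalTensor R X Y) :=
    { smul := fun a z => smulLeft X Y a z
      one_smul := fun z => DFunLike.congr_fun (f := smulLeft X Y 1) (g := AddMonoidHom.id _)
        (BalTensor.hom_ext fun m n => by simp [smulLeft_mk]) z
      mul_smul := fun a b z => DFunLike.congr_fun (f := smulLeft X Y (a * b))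
        (g := (smulLeft X Y a).comp (smulLeft X Y b))
        (BalTensor.hom_ext fun m n => by simp [smulLeft_mk, mul_smul]) z
      smul_zero := fun a => map_zero (smulLeft X Y a)
      smul_add := fun a => map_add (smulLeft X Y a)
      add_smul := fun a b z => DFunLike.congr_fun (f := smulLeft X Y (a + b))
        (g := smulLeft X Y a + smulLeft X Y b)
        (BalTensor.hom_ext fun m n => by simp [smulLeft_mk, add_smul]) z
      zero_smul := fun z => DFunLike.congr_fun (f := smulLeft X Y 0) (g := 0)
        (BalTensor.hom_ext fun m n => by simp [smulLeft_mk]) z }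
  letI r : Module Bᵐᵒᵖ (BalTensor R X Y) :=
    { smul := fun a z => smulRight X Y a z
      one_smul := fun z => DFunLike.congr_fun (f := smulRight X Y 1) (g := AddMonoidHom.id _)
        (BalTensor.hom_ext fun m n => by simp [smulRight_mk]) z
      mul_smul := fun a b z => DFunLike.congr_fun (f := smulRight X Y (a * b))
        (g := (smulRight X Y a).comp (smulRight X Y b))
        (BalTensor.hom_ext fun m n => by simp [smulRight_mk, mul_smul]) z
      smul_zero := fun a => map_zero (smulRight X Y a)
      smul_add := fun a => map_add (smulRight X Y a)
      add_smul := fun a b z => DFunLike.congr_fun (f := smulRight X Y (a + b))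
        (g := smulRight X Y a + smulRight X Y b)
        (BalTensor.hom_ext fun m n => by simp [smulRight_mk, add_smul]) z
      zero_smul := fun z => DFunLike.congr_fun (f := smulRight X Y 0) (g := 0)
        (BalTensor.hom_ext fun m n => by simp [smulRight_mk]) z }
  { carrier := BalTensor R X Y
    left := l
    right := r
    comm := ⟨fun a b z => DFunLike.congr_fun (f := (smulLeft X Y a).comp (smulRight X Y b))
        (g := (smulRight X Y b).comp (smulLeft X Y a))
        (BalTensor.hom_ext fun m n => by simp [smulLeft_mk, smulRight_mk]) z⟩ }

/-- The pure tensor `x ⊗ y`, biadditive in `x` and `y`. -/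
def tmul (X : Bimod A R) (Y : Bimod R B) : X →+ Y →+ tensor X Y := BalTensor.mk R

variable {X : Bimod A R} {Y : Bimod R B}

theorem tmul_smul (x : X) (r : R) (y : Y) : tmul X Y (op r • x) y = tmul X Y x (r • y) :=
  BalTensor.mk_smul x r y

theorem left_tmul (a : A) (x : X) (y : Y) : a • tmul X Y x y = tmul X Y (a • x) y := rfl

theorem right_tmul (b : B) (x : X) (y : Y) : op b • tmul X Y x y = tmul X Y x (op b • y) := rfl

/-- The additive map out of `X ⊗ Y` given by a balanced biadditive map. -/
def lift {P : Type*} [AddCommGroup P] (f : X →+ Y →+ P)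
    (hf : ∀ x (r : R) y, f (op r • x) y = f x (r • y)) : tensor X Y →+ P := BalTensor.lift f hf

@[simp] theorem lift_tmul {P : Type*} [AddCommGroup P] (f : X →+ Y →+ P)
    (hf : ∀ x (r : R) y, f (op r • x) y = f x (r • y)) (x : X) (y : Y) :
    lift f hf (tmul X Y x y) = f x y := rfl

@[elab_as_elim]
theorem tensor_induction {p : tensor X Y → Prop} (z : tensor X Y)
    (tmul : ∀ x y, p (tmul X Y x y)) (add : ∀ x y, p x → p y → p (x + y)) : p z :=
  BalTensor.induction z tmul add

theorem tensor_ext {P : Type*} [AddCommGroup P] {f g : tensor X Y →+ P}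
    (h : ∀ x y, f (tmul X Y x y) = g (tmul X Y x y)) : f = g := BalTensor.hom_ext h

/-- The additive map `f ⊗ g` for a right linear `f` and a left linear `g`. -/
def map {A' B' : Type*} [Ring A'] [Ring B'] {X' : Bimod A' R} {Y' : Bimod R B'}
    (f : X →+ X') (hf : ∀ (r : R) x, f (op r • x) = op r • f x)
    (g : Y →+ Y') (hg : ∀ (r : R) y, g (r • y) = r • g y) : tensor X Y →+ tensor X' Y' :=
  BalTensor.map f hf g hg

@[simp] theorem map_tmul {A' B' : Type*} [Ring A'] [Ring B'] {X' : Bimod A' R} {Y' : Bimod R B'}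
    (f : X →+ X') (hf : ∀ (r : R) x, f (op r • x) = op r • f x)
    (g : Y →+ Y') (hg : ∀ (r : R) y, g (r • y) = r • g y) (x : X) (y : Y) :
    map f hf g hg (tmul X Y x y) = tmul X' Y' (f x) (g y) := rfl

/-- The tensor product of two bimodule homomorphisms. -/
def mapHom {X' : Bimod A R} {Y' : Bimod R B} (f : BimodHom X X') (g : BimodHom Y Y') :
    BimodHom (tensor X Y) (tensor X' Y') where
  toAddMonoidHom := map f.toAddMonoidHom f.map_right g.toAddMonoidHom g.map_left
  map_left a z := by
    change map _ _ _ _ (a • z) = a • map _ _ _ _ z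
    induction z using tensor_induction with
    | tmul x y => exact congrArg (fun t => tmul X' Y' t (g y)) (f.left a x)
    | add x y hx hy => rw [smul_add, map_add, map_add, hx, hy, smul_add]
  map_right b z := by
    change map _ _ _ _ (op b • z) = op b • map _ _ _ _ z
    induction z using tensor_induction with
    | tmul x y => exact congrArg (fun t => tmul X' Y' (f x) t) (g.right b y)
    | add x y hx hy => rw [smul_add, map_add, map_add, hx, hy, smul_add]

@[simp] theorem mapHom_tmul {X' : Bimod A R} {Y' : Bimod R B} (f : BimodHom X X')
    (g : BimodHom Y Y') (x : X) (y : Y) :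
    mapHom f g (tmul X Y x y) = tmul X' Y' (f x) (g y) := rfl

/-- The associativity map `(X ⊗ Y) ⊗ Z → X ⊗ (Y ⊗ Z)`. -/
def assoc {R' : Type*} [Ring R'] (X : Bimod A R) (Y : Bimod R R') (Z : Bimod R' B) :
    tensor (tensor X Y) Z →+ tensor X (tensor Y Z) :=
  lift (lift (AddMonoidHom.mk' (fun x => (AddMonoidHom.compHom (tmul X (tensor Y Z) x)).comp
        (tmul Y Z)) (fun x y => by ext a b; simp))
      (fun x r y => by ext z; exact tmul_smul x r (tmul Y Z y z)))
    (fun t r z => by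
      induction t using tensor_induction with
      | tmul x y => exact congrArg (tmul X (tensor Y Z) x) (tmul_smul y r z)
      | add s t hs ht => simp only [smul_add, map_add, AddMonoidHom.add_apply, hs, ht])

@[simp] theorem assoc_tmul {R' : Type*} [Ring R'] (X : Bimod A R) (Y : Bimod R R')
    (Z : Bimod R' B) (x : X) (y : Y) (z : Z) :
    assoc X Y Z (tmul (tensor X Y) Z (tmul X Y x y) z) =
      tmul X (tensor Y Z) x (tmul Y Z y z) := rfl

/-- The left multiplication `(r, y) ↦ r y` of a bimodule. -/
def lmul (Y : Bimod R B) : R →+ Y →+ Y :=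
  AddMonoidHom.mk' (fun r => DistribSMul.toAddMonoidHom Y r)
    (fun r s => AddMonoidHom.ext fun y => add_smul r s y)

/-- The right multiplication `(x, r) ↦ x r` of a bimodule. -/
def rmul (X : Bimod A R) : X →+ R →+ X :=
  AddMonoidHom.mk' (fun x => AddMonoidHom.mk' (fun r => op r • x)
    (fun r s => by rw [MulOpposite.op_add, add_smul]))
    (fun x y => AddMonoidHom.ext fun r => smul_add (op r) x y)

@[simp] theorem lmul_apply (r : R) (y : Y) : lmul Y r y = r • y := rfl

@[simp] theorem rmul_apply (x : X) (r : R) : rmul X x r = op r • x := rfl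

theorem op_op_smul (x : X) (r s : R) : op s • op r • x = op (r * s) • x := by
  rw [MulOpposite.op_mul, mul_smul]

/-- The map `R ⊗_R Y → Y`, `r ⊗ y ↦ r y`. -/
def lid (Y : Bimod R B) : tensor (regular R) Y →+ Y :=
  lift (X := regular R) (lmul Y) (fun r s y => mul_smul (show R from r) s y)

@[simp] theorem lid_tmul (Y : Bimod R B) (r : R) (y : Y) :
    lid Y (tmul (regular R) Y r y) = r • y := rfl

/-- The map `X ⊗_R R → X`, `x ⊗ r ↦ x r`. -/
def rid (X : Bimod A R) : tensor X (regular R) →+ X :=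
  lift (Y := regular R) (rmul X) (fun x r s => op_op_smul x r (show R from s))

@[simp] theorem rid_tmul (X : Bimod A R) (x : X) (r : R) :
    rid X (tmul X (regular R) x r) = op r • x := rfl

/-- The identity homomorphism. -/
def idHom (X : Bimod A B) : BimodHom X X := ⟨AddMonoidHom.id X, fun _ _ => rfl, fun _ _ => rfl⟩

@[simp] theorem idHom_apply (X : Bimod A B) (x : X) : idHom X x = x := rfl

end Bimod

/-! ### Graded rings and relative differential graded rings -/

/-- Transport along an equality of degrees. -/
def gcast {A : ℕ → Type u} [∀ n, AddCommGroup (A n)] {m n : ℕ} (h : m = n) : A m →+ A n :=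
  h ▸ AddMonoidHom.id (A m)

@[simp] theorem gcast_rfl {A : ℕ → Type u} [∀ n, AddCommGroup (A n)] {n : ℕ} (h : n = n)
    (x : A n) : gcast h x = x := rfl

theorem mk_eq_of_gcast {A : ℕ → Type u} [∀ n, AddCommGroup (A n)] {m n : ℕ} (h : m = n)
    {x : A m} {y : A n} (e : gcast h x = y) : GradedMonoid.mk m x = GradedMonoid.mk n y := by
  subst h; subst e; rfl

theorem of_gcast {A : ℕ → Type u} [∀ n, AddCommGroup (A n)] {m n : ℕ} (h : m = n) (x : A m) :
    DirectSum.of A n (gcast h x) = DirectSum.of A m x := by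
  subst h; rfl

/-- An `ℕ`-graded ring from a biadditive multiplication on its components. -/
@[reducible] def gringMk {A : ℕ → Type u} [∀ n, AddCommGroup (A n)]
    (mul : ∀ m n, A m →+ A n →+ A (m + n)) (one : A 0)
    (one_mul : ∀ n (x : A n), gcast (Nat.zero_add n) (mul 0 n one x) = x)
    (mul_one : ∀ n (x : A n), mul n 0 x one = x)
    (assoc : ∀ l m n (x : A l) (y : A m) (z : A n),
      gcast (Nat.add_assoc l m n) (mul _ _ (mul _ _ x y) z) = mul _ _ x (mul _ _ y z)) :
    DirectSum.GRing A :=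
  letI gmul : GradedMonoid.GMul A := ⟨fun {m n} x y => mul m n x y⟩
  letI gone : GradedMonoid.GOne A := ⟨one⟩
  letI gmonoid : GradedMonoid.GMonoid A :=
    { gmul, gone with
      one_mul := fun ⟨n, x⟩ => mk_eq_of_gcast _ (one_mul n x)
      mul_one := fun ⟨n, x⟩ => mk_eq_of_gcast rfl (mul_one n x)
      mul_assoc := fun ⟨l, x⟩ ⟨m, y⟩ ⟨n, z⟩ => mk_eq_of_gcast _ (assoc l m n x y z) }
  { gmonoid with
    mul_zero := fun x => map_zero _
    zero_mul := fun y => by change mul _ _ 0 y = 0; rw [map_zero]; rfl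
    mul_add := fun x y z => map_add _ _ _
    add_mul := fun x y z => by
      change mul _ _ (x + y) z = mul _ _ x z + mul _ _ y z; rw [map_add]; rfl
    natCast := fun k => k • one
    natCast_zero := zero_smul _ _
    natCast_succ := fun k => by rw [add_smul, one_smul]; rfl
    intCast := fun k => k • one
    intCast_ofNat := fun k => natCast_zsmul _ _
    intCast_negSucc_ofNat := fun k => negSucc_zsmul _ _ }

/-- An `S`-relative differential graded ring (a differential graded algebra over the ring `S`):
an `ℕ`-graded ring `Ω = ⨁ Ωⁿ` with an additive map `d : Ωⁿ → Ωⁿ⁺¹` such that `d ∘ d = 0`,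
satisfying the graded Leibniz rule, and a ring map `η : S → Ω⁰` with `d (η s) = 0`. By the
Leibniz rule `d` is then a map of `(S, S)`-bimodules, see `RelDGRing.D_left` and
`RelDGRing.D_right`. -/
structure RelDGRing (S : Type v) [Ring S] where
  Ω : ℕ → Type u
  [addCommGroup : ∀ n, AddCommGroup (Ω n)]
  [gring : DirectSum.GRing Ω]
  d : ∀ n, Ω n →+ Ω (n + 1)
  d_d : ∀ n (x : Ω n), d (n + 1) (d n x) = 0
  leibniz : ∀ m n (x : Ω m) (y : Ω n),
    DirectSum.of Ω (m + n + 1) (d (m + n) (GradedMonoid.GMul.mul x y)) =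
      DirectSum.of Ω (m + 1) (d m x) * DirectSum.of Ω n y +
        (-1) ^ m * (DirectSum.of Ω m x * DirectSum.of Ω (n + 1) (d n y))
  η : S →+* Ω 0
  d_η : ∀ s, d 0 (η s) = 0

namespace RelDGRing

attribute [instance] RelDGRing.addCommGroup RelDGRing.gring

variable {S : Type v} [Ring S] (A : RelDGRing.{u, v} S)


/-- The differential on the ring `⨁ Ωⁿ`. -/
def D : (⨁ n, A.Ω n) →+ ⨁ n, A.Ω n :=
  DirectSum.toAddMonoid fun n => (DirectSum.of A.Ω (n + 1)).comp (A.d n)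

theorem D_of (n : ℕ) (x : A.Ω n) :
    A.D (DirectSum.of A.Ω n x) = DirectSum.of A.Ω (n + 1) (A.d n x) := by
  simp [D]

theorem D_mul (m : ℕ) (x : A.Ω m) (ω : ⨁ n, A.Ω n) :
    A.D (DirectSum.of A.Ω m x * ω) =
      A.D (DirectSum.of A.Ω m x) * ω + (-1) ^ m * (DirectSum.of A.Ω m x * A.D ω) := by
  induction ω using DirectSum.induction_on with
  | zero => simp
  | of n y => rw [DirectSum.of_mul_of, D_of, D_of, D_of, A.leibniz]
  | add y z hy hz => simp only [mul_add, map_add, hy, hz]; abel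

theorem D_left (s : S) (ω : ⨁ n, A.Ω n) :
    A.D (DirectSum.of A.Ω 0 (A.η s) * ω) = DirectSum.of A.Ω 0 (A.η s) * A.D ω := by
  rw [D_mul, D_of, A.d_η]; simp

theorem D_right (s : S) (ω : ⨁ n, A.Ω n) :
    A.D (ω * DirectSum.of A.Ω 0 (A.η s)) = A.D ω * DirectSum.of A.Ω 0 (A.η s) := by
  induction ω using DirectSum.induction_on with
  | zero => simp
  | of n y => rw [D_mul, D_of _ 0, A.d_η]; simp
  | add y z hy hz => simp only [add_mul, map_add, hy, hz]

/-- An isomorphism of `S`-relative differential graded rings: additive bijections in each degree,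
respecting products, the unit, the differentials and the maps from `S`. -/
structure Iso (A : RelDGRing.{u, v} S) (B : RelDGRing.{w, v} S) where
  equiv : ∀ n, A.Ω n ≃+ B.Ω n
  map_mul : ∀ m n (x : A.Ω m) (y : A.Ω n),
    equiv (m + n) (GradedMonoid.GMul.mul x y) = GradedMonoid.GMul.mul (equiv m x) (equiv n y)
  map_one : equiv 0 GradedMonoid.GOne.one = GradedMonoid.GOne.one
  map_d : ∀ n (x : A.Ω n), equiv (n + 1) (A.d n x) = B.d n (equiv n x)
  map_η : ∀ s, equiv 0 (A.η s) = B.η s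

end RelDGRing

/-! ### The tensor ring of a bimodule -/

section TensorRing

variable {R : Type u} [Ring R]

/-- The component `R ⊗_R M ⊗_R ⋯ ⊗_R M` (`n` factors `M`) of the tensor ring of the bimodule `M`;
the leading factor `R` gives `R` itself for `n = 0` and only matters up to the canonical
isomorphism `R ⊗_R M = M` for `n > 0`. -/
def tpow (M : Bimod.{u, u, u} R R) : ℕ → Bimod.{u, u, u} R R
  | 0 => Bimod.regular R
  | n + 1 => Bimod.tensor (tpow M n) M

variable (M : Bimod.{u, u, u} R R)

/-- An element of `R` in degree zero. -/
def unitR : R →+ tpow M 0 := AddMonoidHom.id R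

/-- `snoc x c` is `x ⊗ c`. -/
def snoc (n : ℕ) : tpow M n →+ M →+ tpow M (n + 1) := Bimod.tmul (tpow M n) M

variable {M}

theorem snoc_smul {n : ℕ} (x : tpow M n) (r : R) (c : M) :
    snoc M n (op r • x) c = snoc M n x (r • c) := Bimod.tmul_smul x r c

theorem left_snoc {n : ℕ} (r : R) (x : tpow M n) (c : M) :
    r • snoc M n x c = snoc M n (r • x) c := rfl

theorem right_snoc {n : ℕ} (r : R) (x : tpow M n) (c : M) :
    op r • snoc M n x c = snoc M n x (op r • c) := rfl

theorem left_unitR (r s : R) : r • unitR M s = unitR M (r * s) := rfl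

theorem right_unitR (r s : R) : op r • unitR M s = unitR M (s * r) := rfl

/-- Maps out of `tpow M (n + 1)`. -/
def snocLift {P : Type*} [AddCommGroup P] {n : ℕ} (f : tpow M n →+ M →+ P)
    (hf : ∀ x (r : R) c, f (op r • x) c = f x (r • c)) : tpow M (n + 1) →+ P :=
  Bimod.lift f hf

@[simp] theorem snocLift_snoc {P : Type*} [AddCommGroup P] {n : ℕ} (f : tpow M n →+ M →+ P)
    (hf : ∀ x (r : R) c, f (op r • x) c = f x (r • c)) (x : tpow M n) (c : M) :
    snocLift f hf (snoc M n x c) = f x c := rfl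

@[elab_as_elim]
theorem tpow_cases {n : ℕ} {p : tpow M (n + 1) → Prop} (z : tpow M (n + 1))
    (snoc : ∀ x c, p (snoc M n x c)) (add : ∀ x y, p x → p y → p (x + y)) : p z :=
  Bimod.tensor_induction z snoc add

/-- The map `(x, y ⊗ c) ↦ f (x, y) ⊗ c`. -/
def snocStep {P : Type*} [AddCommGroup P] {n k : ℕ} (f : P →+ tpow M n →+ tpow M k)
    (hf : ∀ x (r : R) y, f x (op r • y) = op r • f x y) : P →+ tpow M (n + 1) →+ tpow M (k + 1) :=
  AddMonoidHom.mk' (fun x => snocLift ((snoc M k).comp (f x))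
    (fun y r c => by simp only [AddMonoidHom.comp_apply, hf]; exact snoc_smul _ _ _))
    (fun x y => Bimod.tensor_ext fun z c => by
      change snoc M k (f (x + y) z) c = snoc M k (f x z) c + snoc M k (f y z) c
      simp only [map_add, AddMonoidHom.add_apply])

theorem snocStep_right {P : Type*} [AddCommGroup P] {n k : ℕ} (f : P →+ tpow M n →+ tpow M k)
    (hf : ∀ x (r : R) y, f x (op r • y) = op r • f x y) (x : P) (r : R) (y : tpow M (n + 1)) :
    snocStep f hf x (op r • y) = op r • snocStep f hf x y := by
  induction y using tpow_cases with
  | snoc y c => rfl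
  | add y z hy hz => rw [smul_add, map_add, map_add, hy, hz, smul_add]

/-- Multiplication of the tensor ring, with its right linearity. -/
def tensMulAux (m : ℕ) : ∀ n, {f : tpow M m →+ tpow M n →+ tpow M (m + n) //
    ∀ x (r : R) y, f x (op r • y) = op r • f x y}
  | 0 => ⟨Bimod.rmul (tpow M m), fun x r y => (Bimod.op_op_smul x (show R from y) r).symm⟩
  | n + 1 => ⟨snocStep (tensMulAux m n).1 (tensMulAux m n).2,
      snocStep_right (tensMulAux m n).1 (tensMulAux m n).2⟩

/-- Multiplication of the tensor ring: concatenation of tensors. -/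
def tensMul (m n : ℕ) : tpow M m →+ tpow M n →+ tpow M (m + n) := (tensMulAux m n).1

theorem tensMul_right {m n : ℕ} (x : tpow M m) (r : R) (y : tpow M n) :
    tensMul m n x (op r • y) = op r • tensMul m n x y := (tensMulAux m n).2 x r y

@[simp] theorem tensMul_unitR {m : ℕ} (x : tpow M m) (r : R) :
    tensMul m 0 x (unitR M r) = op r • x := rfl

@[simp] theorem tensMul_snoc {m n : ℕ} (x : tpow M m) (y : tpow M n) (c : M) :
    tensMul m (n + 1) x (snoc M n y c) = snoc M (m + n) (tensMul m n x y) c := rfl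

theorem gcast_snoc {m n : ℕ} (h : m = n) (x : tpow M m) (c : M) :
    gcast (A := fun n => tpow M n) (congrArg (· + 1) h) (snoc M m x c) =
      snoc M n (gcast (A := fun n => tpow M n) h x) c := by
  subst h; rfl

theorem unitR_tensMul (n : ℕ) (x : tpow M n) :
    gcast (A := fun n => tpow M n) (Nat.zero_add n) (tensMul 0 n (unitR M 1) x) = x := by
  induction n with
  | zero => exact one_mul (M := R) x
  | succ n ih =>
    induction x using tpow_cases with
    | snoc x c =>
      rw [tensMul_snoc]
      exact (gcast_snoc (Nat.zero_add n) _ c).trans (by rw [ih])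
    | add x y hx hy => rw [map_add, map_add, hx, hy]

theorem tensMul_assoc (l m n : ℕ) (x : tpow M l) (y : tpow M m) (z : tpow M n) :
    gcast (A := fun n => tpow M n) (Nat.add_assoc l m n) (tensMul _ _ (tensMul _ _ x y) z) =
      tensMul _ _ x (tensMul _ _ y z) := by
  induction n with
  | zero => exact (tensMul_right x (z : R) y).symm
  | succ n ih =>
    induction z using tpow_cases with
    | snoc z c =>
      rw [tensMul_snoc, tensMul_snoc]
      exact (gcast_snoc (Nat.add_assoc l m n) _ c).trans (by rw [ih]; rfl)
    | add z w hz hw => rw [map_add, map_add, hz, hw, map_add, map_add]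

/-- The tensor ring of a bimodule, as a graded ring. -/
@[reducible] def tensorRing (M : Bimod.{u, u, u} R R) : DirectSum.GRing (fun n => tpow M n) :=
  gringMk tensMul (unitR M 1) unitR_tensMul (fun _ x => one_smul Rᵐᵒᵖ x) tensMul_assoc

/-- The map of tensor powers induced by a bimodule homomorphism. -/
def tpowMap {M N : Bimod.{u, u, u} R R} (f : BimodHom M N) : ∀ n, BimodHom (tpow M n) (tpow N n)
  | 0 => ⟨AddMonoidHom.id R, fun _ _ => rfl, fun _ _ => rfl⟩
  | n + 1 => Bimod.mapHom (tpowMap f n) f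

@[simp] theorem tpowMap_unitR {M N : Bimod.{u, u, u} R R} (f : BimodHom M N) (r : R) :
    tpowMap f 0 (unitR M r) = unitR N r := rfl

@[simp] theorem tpowMap_snoc {M N : Bimod.{u, u, u} R R} (f : BimodHom M N) {n : ℕ}
    (x : tpow M n) (c : M) : tpowMap f (n + 1) (snoc M n x c) = snoc N n (tpowMap f n x) (f c) :=
  rfl

theorem tpowMap_mul {M N : Bimod.{u, u, u} R R} (f : BimodHom M N) (m n : ℕ)
    (x : tpow M m) (y : tpow M n) :
    tpowMap f (m + n) (tensMul m n x y) = tensMul m n (tpowMap f m x) (tpowMap f n y) := by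
  induction n with
  | zero => exact (tpowMap f m).right y x
  | succ n ih =>
    induction y using tpow_cases with
    | snoc y c => rw [tensMul_snoc, tpowMap_snoc, tensMul_snoc, ← ih]; rfl
    | add y z hy hz => simp only [map_add, hy, hz]

end TensorRing

/-! ### Corings and the Amitsur complex -/

/-- An `R`-coring: an `(R, R)`-bimodule `C` with bimodule maps `Δ : C → C ⊗_R C` and `ε : C → R`
which are coassociative and counital. -/
structure Coring (R : Type u) [Ring R] where
  C : Bimod.{u, u, u} R R
  Δ : BimodHom C (Bimod.tensor C C)
  ε : BimodHom C (Bimod.regular R)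
  coassoc : ∀ c, Bimod.assoc C C C (Bimod.mapHom Δ (Bimod.idHom C) (Δ c)) =
    Bimod.mapHom (Bimod.idHom C) Δ (Δ c)
  counit_left : ∀ c, Bimod.lid C (Bimod.mapHom ε (Bimod.idHom C) (Δ c)) = c
  counit_right : ∀ c, Bimod.rid C (Bimod.mapHom (Bimod.idHom C) ε (Δ c)) = c

namespace Coring

variable {R : Type u} [Ring R] (𝒞 : Coring R)

/-- The counit with values in `R`. -/
def counit : 𝒞.C →+ R := 𝒞.ε.toAddMonoidHom

theorem counit_smul (r : R) (c : 𝒞.C) : 𝒞.counit (r • c) = r * 𝒞.counit c := 𝒞.ε.left r c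

theorem counit_op_smul (r : R) (c : 𝒞.C) : 𝒞.counit (op r • c) = 𝒞.counit c * r := 𝒞.ε.right r c

/-- Grouplike elements: `Δ g = g ⊗ g` and `ε g = 1` (so that `g ≠ 0` unless `R` is trivial). -/
structure IsGrouplike (g : 𝒞.C) : Prop where
  comul : 𝒞.Δ g = Bimod.tmul 𝒞.C 𝒞.C g g
  counit : 𝒞.counit g = 1

/-- The kernel of the counit, as an `(R, R)`-bimodule. -/
def kerCounit : Bimod.{u, u, u} R R :=
  letI l : Module R 𝒞.counit.ker :=
    { smul := fun r c => ⟨r • c.1, by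
        have h : 𝒞.counit c.1 = 0 := c.2
        change 𝒞.counit (r • c.1) = 0
        rw [counit_smul, h, mul_zero]⟩
      one_smul := fun c => Subtype.ext (one_smul R c.1)
      mul_smul := fun r s c => Subtype.ext (mul_smul r s c.1)
      smul_zero := fun r => Subtype.ext (smul_zero r)
      smul_add := fun r c c' => Subtype.ext (smul_add r c.1 c'.1)
      add_smul := fun r s c => Subtype.ext (add_smul r s c.1)
      zero_smul := fun c => Subtype.ext (zero_smul R c.1) }
  letI r : Module Rᵐᵒᵖ 𝒞.counit.ker :=
    { smul := fun r c => ⟨r • c.1, by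
        have h : 𝒞.counit c.1 = 0 := c.2
        change 𝒞.counit (op r.unop • c.1) = 0
        rw [counit_op_smul, h, zero_mul]⟩
      one_smul := fun c => Subtype.ext (one_smul Rᵐᵒᵖ c.1)
      mul_smul := fun r s c => Subtype.ext (mul_smul r s c.1)
      smul_zero := fun r => Subtype.ext (smul_zero r)
      smul_add := fun r c c' => Subtype.ext (smul_add r c.1 c'.1)
      add_smul := fun r s c => Subtype.ext (add_smul r s c.1)
      zero_smul := fun c => Subtype.ext (zero_smul Rᵐᵒᵖ c.1) }
  { carrier := 𝒞.counit.ker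
    left := l
    right := r
    comm := ⟨fun r s c => Subtype.ext (smul_comm r s c.1)⟩ }

/-- The inclusion of the kernel of the counit. -/
def kerIncl : BimodHom 𝒞.kerCounit 𝒞.C := ⟨𝒞.counit.ker.subtype, fun _ _ => rfl, fun _ _ => rfl⟩

/-- An element of the kernel of the counit. -/
def kerMk (c : 𝒞.C) (h : 𝒞.counit c = 0) : 𝒞.kerCounit := (⟨c, h⟩ : 𝒞.counit.ker)

@[simp] theorem kerIncl_kerMk (c : 𝒞.C) (h : 𝒞.counit c = 0) : 𝒞.kerIncl (𝒞.kerMk c h) = c := rfl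

theorem counit_kerIncl (k : 𝒞.kerCounit) : 𝒞.counit (𝒞.kerIncl k) = 0 :=
  (show 𝒞.counit.ker from k).2

theorem kerIncl_injective : Function.Injective 𝒞.kerIncl := fun _ _ h => Subtype.ext h

/-- `cons c x` is `c ⊗ x`, that is `1 ⊗ c ⊗ x` for `x` of positive degree and
`1 ⊗ c r` for `x = r ∈ R`. -/
def cons (c : 𝒞.C) : ∀ n, {f : tpow 𝒞.C n →+ tpow 𝒞.C (n + 1) //
    ∀ (r : R) x, f (op r • x) = op r • f x}
  | 0 => ⟨(snoc 𝒞.C 0 (unitR 𝒞.C 1)).comp (Bimod.rmul 𝒞.C c), fun r x => by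
      change snoc 𝒞.C 0 (unitR 𝒞.C 1) (op ((show R from x) * r) • c) = _
      rw [MulOpposite.op_mul, mul_smul]; rfl⟩
  | n + 1 => ⟨snocLift ((snoc 𝒞.C (n + 1)).comp (cons c n).1) (fun x r k => by
        simp only [AddMonoidHom.comp_apply, (cons c n).2]
        exact snoc_smul _ _ _), fun r x => by
        induction x using tpow_cases with
        | snoc x k => rfl
        | add x y hx hy => rw [smul_add, map_add, map_add, hx, hy, smul_add]⟩

/-- `snoc₂ x (c ⊗ c')` is `x ⊗ c ⊗ c'`. -/
def snoc₂ {M : Bimod.{u, u, u} R R} {n : ℕ} (x : tpow M n) :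
    Bimod.tensor M M →+ tpow M (n + 2) :=
  Bimod.lift ((snoc M (n + 1)).comp (snoc M n x)) (fun c r c' => by
    simp only [AddMonoidHom.comp_apply, ← right_snoc]
    exact snoc_smul _ _ _)

@[simp] theorem snoc₂_tmul {M : Bimod.{u, u, u} R R} {n : ℕ} (x : tpow M n) (c c' : M) :
    snoc₂ x (Bimod.tmul M M c c') = snoc M (n + 1) (snoc M n x c) c' := rfl

theorem snoc₂_right {M : Bimod.{u, u, u} R R} {n : ℕ} (x : tpow M n) (r : R)
    (z : Bimod.tensor M M) : snoc₂ x (op r • z) = op r • snoc₂ x z := by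
  induction z using Bimod.tensor_induction with
  | tmul c c' => rfl
  | add z w hz hw => rw [smul_add, map_add, map_add, hz, hw, smul_add]

theorem snoc₂_smul {M : Bimod.{u, u, u} R R} {n : ℕ} (x : tpow M n) (r : R)
    (z : Bimod.tensor M M) : snoc₂ (op r • x) z = snoc₂ x (r • z) := by
  induction z using Bimod.tensor_induction with
  | tmul c c' =>
    rw [snoc₂_tmul, snoc_smul]; rfl
  | add z w hz hw => rw [smul_add, map_add, map_add, hz, hw]

theorem snoc₂_add {M : Bimod.{u, u, u} R R} {n : ℕ} (x y : tpow M n)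
    (z : Bimod.tensor M M) : snoc₂ (x + y) z = snoc₂ x z + snoc₂ y z := by
  induction z using Bimod.tensor_induction with
  | tmul c c' => simp only [snoc₂_tmul, map_add, AddMonoidHom.add_apply]
  | add z w hz hw => rw [map_add, map_add, map_add, hz, hw]; abel

/-- The map `(x, c) ↦ x ⊗ Δ c`. -/
def snocΔ (n : ℕ) : tpow 𝒞.C n →+ 𝒞.C →+ tpow 𝒞.C (n + 2) :=
  AddMonoidHom.mk' (fun x => (snoc₂ x).comp 𝒞.Δ.toAddMonoidHom)
    (fun x y => by ext c; exact snoc₂_add x y (𝒞.Δ c))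

theorem snocΔ_apply {n : ℕ} (x : tpow 𝒞.C n) (c : 𝒞.C) : 𝒞.snocΔ n x c = snoc₂ x (𝒞.Δ c) := rfl

theorem snocΔ_smul {n : ℕ} (x : tpow 𝒞.C n) (r : R) (c : 𝒞.C) :
    𝒞.snocΔ n (op r • x) c = 𝒞.snocΔ n x (r • c) := by
  rw [snocΔ_apply, snocΔ_apply, snoc₂_smul, 𝒞.Δ.left]

theorem snocΔ_right {n : ℕ} (x : tpow 𝒞.C n) (r : R) (c : 𝒞.C) :
    𝒞.snocΔ n x (op r • c) = op r • 𝒞.snocΔ n x c := by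
  rw [snocΔ_apply, snocΔ_apply, 𝒞.Δ.right, snoc₂_right]

/-- The alternating sum `∑ᵢ (-1)ⁱ c¹ ⊗ ⋯ ⊗ Δ cⁱ ⊗ ⋯ ⊗ cⁿ` over `1 ≤ i ≤ n`. -/
def innerSum : ∀ n, {f : tpow 𝒞.C n →+ tpow 𝒞.C (n + 1) // ∀ (r : R) x, f (op r • x) = op r • f x}
  | 0 => ⟨0, fun r x => (smul_zero _).symm⟩
  | n + 1 => ⟨snocLift ((snoc 𝒞.C (n + 1)).comp (innerSum n).1 + (-1 : ℤ) ^ (n + 1) • 𝒞.snocΔ n)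
      (fun x r c => by
        simp only [AddMonoidHom.add_apply, AddMonoidHom.comp_apply, (innerSum n).2,
          AddMonoidHom.zsmul_apply, snocΔ_smul]
        rw [snoc_smul]), fun r x => by
        induction x using tpow_cases with
        | snoc x k =>
          rw [right_snoc, snocLift_snoc, snocLift_snoc]
          simp only [AddMonoidHom.add_apply, AddMonoidHom.comp_apply,
            AddMonoidHom.zsmul_apply, snocΔ_right, smul_add]
          rw [smul_comm]; rfl
        | add x y hx hy => rw [smul_add, map_add, map_add, hx, hy, smul_add]⟩

/-- The Amitsur differential
`d (c¹ ⊗ ⋯ ⊗ cⁿ) = g ⊗ c¹ ⊗ ⋯ ⊗ cⁿ + ∑ᵢ (-1)ⁱ c¹ ⊗ ⋯ ⊗ Δ cⁱ ⊗ ⋯ ⊗ cⁿ + (-1)ⁿ⁺¹ c¹ ⊗ ⋯ ⊗ cⁿ ⊗ g`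
on the tensor ring of the coring; in degree zero it is `d r = g r - r g`. -/
def amitsur (g : 𝒞.C) (n : ℕ) : tpow 𝒞.C n →+ tpow 𝒞.C (n + 1) :=
  (𝒞.cons g n).1 + (𝒞.innerSum n).1 + (-1 : ℤ) ^ (n + 1) • (snoc 𝒞.C n).flip g

theorem amitsur_apply (g : 𝒞.C) {n : ℕ} (x : tpow 𝒞.C n) :
    𝒞.amitsur g n x =
      (𝒞.cons g n).1 x + (𝒞.innerSum n).1 x + (-1 : ℤ) ^ (n + 1) • snoc 𝒞.C n x g := rfl

theorem amitsur_unitR (g : 𝒞.C) (r : R) :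
    𝒞.amitsur g 0 (unitR 𝒞.C r) = snoc 𝒞.C 0 (unitR 𝒞.C 1) (op r • g - r • g) := by
  have h : snoc 𝒞.C 0 (unitR 𝒞.C r) g = snoc 𝒞.C 0 (unitR 𝒞.C 1) (r • g) := by
    rw [← snoc_smul, right_unitR, one_mul]
  simp only [amitsur, AddMonoidHom.add_apply, AddMonoidHom.zsmul_apply, AddMonoidHom.flip_apply, h]
  change snoc 𝒞.C 0 (unitR 𝒞.C 1) (op r • g) + 0 + _ = _
  simp [sub_eq_add_neg]

/-- `g ⊗ c - Δ c + c ⊗ g`, the differential of an element of degree one. -/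
def delta (g : 𝒞.C) : 𝒞.C →+ Bimod.tensor 𝒞.C 𝒞.C :=
  Bimod.tmul 𝒞.C 𝒞.C g - 𝒞.Δ.toAddMonoidHom + (Bimod.tmul 𝒞.C 𝒞.C).flip g

theorem delta_apply (g c : 𝒞.C) : 𝒞.delta g c =
    Bimod.tmul 𝒞.C 𝒞.C g c - 𝒞.Δ c + Bimod.tmul 𝒞.C 𝒞.C c g := rfl

theorem amitsur_snoc (g : 𝒞.C) {n : ℕ} (x : tpow 𝒞.C n) (c : 𝒞.C) :
    𝒞.amitsur g (n + 1) (snoc 𝒞.C n x c) =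
      snoc 𝒞.C (n + 1) (𝒞.amitsur g n x) c + (-1 : ℤ) ^ n • snoc₂ x (𝒞.delta g c) := by
  have h1 : (𝒞.cons g (n + 1)).1 (snoc 𝒞.C n x c) = snoc 𝒞.C (n + 1) ((𝒞.cons g n).1 x) c := rfl
  have h2 : (𝒞.innerSum (n + 1)).1 (snoc 𝒞.C n x c) =
    snoc 𝒞.C (n + 1) ((𝒞.innerSum n).1 x) c + (-1 : ℤ) ^ (n + 1) • snoc₂ x (𝒞.Δ c) := rfl
  simp only [amitsur, AddMonoidHom.add_apply, AddMonoidHom.zsmul_apply, AddMonoidHom.flip_apply,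
    h1, h2, map_add, delta_apply, map_sub, snoc₂_tmul, map_zsmul, smul_add, smul_sub, pow_succ,
    mul_neg, mul_one, neg_smul, neg_neg, map_neg, AddMonoidHom.neg_apply]
  abel

theorem amitsur_right (g : 𝒞.C) {n : ℕ} (x : tpow 𝒞.C n) (r : R) :
    𝒞.amitsur g n (op r • x) =
      op r • 𝒞.amitsur g n x + (-1 : ℤ) ^ n • snoc 𝒞.C n x (op r • g - r • g) := by
  have h : op r • snoc 𝒞.C n x g = snoc 𝒞.C n x (op r • g) := rfl
  rw [amitsur_apply, amitsur_apply, (𝒞.cons g n).2, (𝒞.innerSum n).2, snoc_smul, smul_add,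
    smul_add, smul_comm (op r), h, map_sub]
  simp only [smul_sub, pow_succ, mul_neg, mul_one, neg_smul]
  abel

theorem tensMul_snoc₂ {M : Bimod.{u, u, u} R R} {m n : ℕ} (x : tpow M m) (y : tpow M n)
    (z : Bimod.tensor M M) :
    tensMul m (n + 2) x (snoc₂ y z) = snoc₂ (tensMul m n x y) z := by
  induction z using Bimod.tensor_induction with
  | tmul c c' => rfl
  | add z w hz hw =>
    rw [map_add, map_add, map_add, hz, hw]

theorem amitsur_mul (g : 𝒞.C) (m n : ℕ) (x : tpow 𝒞.C m) (y : tpow 𝒞.C n) :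
    𝒞.amitsur g (m + n) (tensMul m n x y) =
      gcast (A := fun n => tpow 𝒞.C n) (Nat.succ_add m n)
        (tensMul (m + 1) n (𝒞.amitsur g m x) y) +
      (-1 : ℤ) ^ m • tensMul m (n + 1) x (𝒞.amitsur g n y) := by
  induction n with
  | zero =>
    have h : 𝒞.amitsur g 0 y = snoc 𝒞.C 0 (unitR 𝒞.C 1) (op (show R from y) • g - (show R from y) • g) :=
      𝒞.amitsur_unitR g y
    rw [h]
    refine (𝒞.amitsur_right g x y).trans ?_
    rw [tensMul_snoc, tensMul_unitR, MulOpposite.op_one, one_smul]; rfl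
  | succ n ih =>
    induction y using tpow_cases with
    | snoc y c =>
      rw [tensMul_snoc, tensMul_snoc, amitsur_snoc, map_add, map_zsmul, tensMul_snoc₂]
      refine (𝒞.amitsur_snoc g (tensMul m n x y) c).trans ?_
      rw [ih, map_add, AddMonoidHom.add_apply, map_zsmul, AddMonoidHom.zsmul_apply, smul_add,
        smul_smul, ← pow_add]
      refine (add_assoc _ _ _).trans ?_
      exact congrArg₂ (· + ·) (gcast_snoc (Nat.succ_add m n) _ c).symm rfl
    | add y z hy hz =>
      simp only [map_add, smul_add]
      refine (congrArg₂ (· + ·) hy hz).trans ?_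
      exact add_add_add_comm _ _ _ _

end Coring

namespace Coring

variable {R : Type u} [Ring R] (𝒞 : Coring R)

/-! #### The Amitsur differential squares to zero -/

section Square

variable {M : Bimod.{u, u, u} R R} {n : ℕ}

/-- The map `(c ⊗ c') ⊗ c'' ↦ x ⊗ c ⊗ c' ⊗ c''`. -/
def snoc₃L (x : tpow M n) : Bimod.tensor (Bimod.tensor M M) M →+ tpow M (n + 3) :=
  Bimod.lift ((snoc M (n + 2)).comp (snoc₂ x)) (fun t r c => by
    rw [AddMonoidHom.comp_apply, AddMonoidHom.comp_apply, snoc₂_right, snoc_smul])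

/-- The map `c ⊗ (c' ⊗ c'') ↦ x ⊗ c ⊗ c' ⊗ c''`. -/
def snoc₃R (x : tpow M n) : Bimod.tensor M (Bimod.tensor M M) →+ tpow M (n + 3) :=
  Bimod.lift (AddMonoidHom.mk' (fun c => snoc₂ (snoc M n x c))
    (fun c c' => by ext t; rw [map_add, snoc₂_add]; rfl))
    (fun c r t => by
      change snoc₂ (snoc M n x (op r • c)) t = snoc₂ (snoc M n x c) (r • t)
      rw [← right_snoc, snoc₂_smul])

theorem snoc₃L_tmul (x : tpow M n) (t : Bimod.tensor M M) (c : M) :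
    snoc₃L x (Bimod.tmul (Bimod.tensor M M) M t c) = snoc M (n + 2) (snoc₂ x t) c := rfl

theorem snoc₃R_tmul (x : tpow M n) (c : M) (t : Bimod.tensor M M) :
    snoc₃R x (Bimod.tmul M (Bimod.tensor M M) c t) = snoc₂ (snoc M n x c) t := rfl

theorem snoc₃R_assoc (x : tpow M n) (z : Bimod.tensor (Bimod.tensor M M) M) :
    snoc₃R x (Bimod.assoc M M M z) = snoc₃L x z := by
  induction z using Bimod.tensor_induction with
  | tmul t c =>
    induction t using Bimod.tensor_induction with
    | tmul a b => rfl
    | add s t hs ht => simp only [map_add, AddMonoidHom.add_apply, hs, ht]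
  | add z w hz hw => rw [map_add, map_add, map_add, hz, hw]

end Square

theorem amitsur_snoc₂ (g : 𝒞.C) {n : ℕ} (x : tpow 𝒞.C n) (z : Bimod.tensor 𝒞.C 𝒞.C) :
    𝒞.amitsur g (n + 2) (snoc₂ x z) = snoc₂ (𝒞.amitsur g n x) z +
      (-1 : ℤ) ^ n • (snoc₂ (snoc 𝒞.C n x g) z -
        snoc₃L x (Bimod.mapHom 𝒞.Δ (Bimod.idHom 𝒞.C) z) +
        snoc₃R x (Bimod.mapHom (Bimod.idHom 𝒞.C) 𝒞.Δ z) -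
        snoc 𝒞.C (n + 2) (snoc₂ x z) g) := by
  induction z using Bimod.tensor_induction with
  | tmul c c' =>
    simp only [Bimod.mapHom_tmul, snoc₃L_tmul, snoc₃R_tmul, Bimod.idHom_apply, snoc₂_tmul,
      amitsur_snoc, delta_apply, map_add, map_sub, map_zsmul, AddMonoidHom.add_apply,
      AddMonoidHom.sub_apply, AddMonoidHom.zsmul_apply, smul_add, smul_sub, pow_succ, mul_neg,
      mul_one, neg_smul]
    abel
  | add z w hz hw =>
    simp only [map_add, hz, hw, smul_add, smul_sub, AddMonoidHom.add_apply]
    abel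

theorem amitsur_amitsur {g : 𝒞.C} (hg : 𝒞.IsGrouplike g) (n : ℕ) (x : tpow 𝒞.C n) :
    𝒞.amitsur g (n + 1) (𝒞.amitsur g n x) = 0 := by
  induction n with
  | zero =>
    change 𝒞.amitsur g 1 (𝒞.amitsur g 0 (unitR 𝒞.C (show R from x))) = 0
    generalize (show R from x) = r
    have h1 : 𝒞.amitsur g 0 (unitR 𝒞.C 1) = 0 := by
      rw [amitsur_unitR, MulOpposite.op_one, one_smul, one_smul, sub_self, map_zero]
    have h2 : 𝒞.delta g (op r • g - r • g) = 0 := by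
      have e : Bimod.tmul 𝒞.C 𝒞.C (op r • g) g = Bimod.tmul 𝒞.C 𝒞.C g (r • g) :=
        Bimod.tmul_smul g r g
      rw [delta_apply]
      simp only [map_sub, AddMonoidHom.sub_apply, 𝒞.Δ.left, 𝒞.Δ.right, hg.comul,
        Bimod.left_tmul, Bimod.right_tmul, e]
      abel
    rw [amitsur_unitR, amitsur_snoc, h1, h2]
    simp
  | succ n ih =>
    induction x using tpow_cases with
    | snoc x c =>
      have key : snoc₃L x (Bimod.mapHom 𝒞.Δ (Bimod.idHom 𝒞.C) (𝒞.Δ c)) =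
          snoc₃R x (Bimod.mapHom (Bimod.idHom 𝒞.C) 𝒞.Δ (𝒞.Δ c)) := by
        rw [← snoc₃R_assoc, 𝒞.coassoc]
      rw [amitsur_snoc, map_add, amitsur_snoc, ih, map_zsmul, amitsur_snoc₂]
      simp only [delta_apply, map_add, map_sub, Bimod.mapHom_tmul, snoc₃L_tmul, snoc₃R_tmul,
        Bimod.idHom_apply, hg.comul, snoc₂_tmul, key, AddMonoidHom.add_apply, map_zero,
        AddMonoidHom.sub_apply, AddMonoidHom.zero_apply, smul_add, smul_sub, pow_succ, mul_neg,
        mul_one, neg_smul]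
      abel
    | add x y hx hy => rw [map_add, map_add, hx, hy, add_zero]

/-! #### The forms with values in a coring -/

variable {𝒞}

/-- The right linear projection `c ↦ c - g ε(c)` onto the kernel of the counit. -/
def projR {g : 𝒞.C} (hg : 𝒞.IsGrouplike g) : 𝒞.C →+ 𝒞.kerCounit :=
  AddMonoidHom.mk' (fun c => 𝒞.kerMk (c - op (𝒞.counit c) • g) (by
      rw [map_sub, counit_op_smul, hg.counit, one_mul, sub_self]))
    (fun c c' => 𝒞.kerIncl_injective (by
      simp only [kerIncl_kerMk, map_add, MulOpposite.op_add, add_smul]; abel))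

/-- The left linear projection `c ↦ c - ε(c) g` onto the kernel of the counit. -/
def projL {g : 𝒞.C} (hg : 𝒞.IsGrouplike g) : 𝒞.C →+ 𝒞.kerCounit :=
  AddMonoidHom.mk' (fun c => 𝒞.kerMk (c - 𝒞.counit c • g) (by
      rw [map_sub, counit_smul, hg.counit, mul_one, sub_self]))
    (fun c c' => 𝒞.kerIncl_injective (by
      simp only [kerIncl_kerMk, map_add, add_smul]; abel))

section

variable {g : 𝒞.C} (hg : 𝒞.IsGrouplike g)

theorem kerIncl_projR (c : 𝒞.C) : 𝒞.kerIncl (projR hg c) = c - op (𝒞.counit c) • g := rfl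

theorem kerIncl_projL (c : 𝒞.C) : 𝒞.kerIncl (projL hg c) = c - 𝒞.counit c • g := rfl

theorem projR_right (r : R) (c : 𝒞.C) : projR hg (op r • c) = op r • projR hg c := by
  apply 𝒞.kerIncl_injective
  rw [BimodHom.right, kerIncl_projR, kerIncl_projR, counit_op_smul, MulOpposite.op_mul, mul_smul,
    smul_sub]

theorem projL_left (r : R) (c : 𝒞.C) : projL hg (r • c) = r • projL hg c := by
  apply 𝒞.kerIncl_injective
  rw [BimodHom.left, kerIncl_projL, kerIncl_projL, counit_smul, mul_smul, smul_sub]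

theorem projL_kerIncl (k : 𝒞.kerCounit) : projL hg (𝒞.kerIncl k) = k := by
  apply 𝒞.kerIncl_injective
  rw [kerIncl_projL, counit_kerIncl, zero_smul, sub_zero]

/-- The element `g r - r g` of the kernel of the counit. -/
def dZero (r : R) : 𝒞.kerCounit := 𝒞.kerMk (op r • g - r • g) (by
  rw [map_sub, counit_op_smul, counit_smul, hg.counit, mul_one, one_mul, sub_self])

theorem projL_right (r : R) (c : 𝒞.C) :
    projL hg (op r • c) = op r • projL hg c + 𝒞.counit c • dZero hg r := by
  apply 𝒞.kerIncl_injective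
  rw [map_add, BimodHom.right, BimodHom.left, kerIncl_projL, kerIncl_projL, counit_op_smul,
    dZero, kerIncl_kerMk, smul_sub, smul_sub, mul_smul, ← smul_comm (𝒞.counit c) (op r)]
  abel

/-- The map `c ⊗ c' ↦ (c - g ε(c)) ⊗ (c' - ε(c') g)`. -/
def proj₂ : Bimod.tensor 𝒞.C 𝒞.C →+ Bimod.tensor 𝒞.kerCounit 𝒞.kerCounit :=
  Bimod.map (projR hg) (projR_right hg) (projL hg) (projL_left hg)

theorem proj₂_tmul (c c' : 𝒞.C) : proj₂ hg (Bimod.tmul 𝒞.C 𝒞.C c c') =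
    Bimod.tmul _ _ (projR hg c) (projL hg c') := rfl

theorem incl_proj₂ (z : Bimod.tensor 𝒞.C 𝒞.C) :
    Bimod.mapHom 𝒞.kerIncl 𝒞.kerIncl (proj₂ hg z) = z -
      Bimod.tmul 𝒞.C 𝒞.C g (Bimod.lid 𝒞.C (Bimod.mapHom 𝒞.ε (Bimod.idHom 𝒞.C) z)) -
      Bimod.tmul 𝒞.C 𝒞.C (Bimod.rid 𝒞.C (Bimod.mapHom (Bimod.idHom 𝒞.C) 𝒞.ε z)) g +
      Bimod.tmul 𝒞.C 𝒞.C
        (op (𝒞.counit (Bimod.rid 𝒞.C (Bimod.mapHom (Bimod.idHom 𝒞.C) 𝒞.ε z))) • g) g := by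
  induction z using Bimod.tensor_induction with
  | tmul c c' =>
    have h1 : Bimod.lid 𝒞.C (Bimod.mapHom 𝒞.ε (Bimod.idHom 𝒞.C) (Bimod.tmul 𝒞.C 𝒞.C c c')) =
      𝒞.counit c • c' := rfl
    have h2 : Bimod.rid 𝒞.C (Bimod.mapHom (Bimod.idHom 𝒞.C) 𝒞.ε (Bimod.tmul 𝒞.C 𝒞.C c c')) =
      op (𝒞.counit c') • c := rfl
    rw [h1, h2, proj₂_tmul, Bimod.mapHom_tmul, kerIncl_projR, kerIncl_projL, counit_op_smul]
    simp only [map_sub, AddMonoidHom.sub_apply, ← Bimod.tmul_smul, MulOpposite.op_mul, mul_smul]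
    abel
  | add z w hz hw =>
    simp only [map_add, hz, hw, MulOpposite.op_add, add_smul, AddMonoidHom.add_apply]
    abel

theorem incl_proj₂_Δ (k : 𝒞.kerCounit) :
    Bimod.mapHom 𝒞.kerIncl 𝒞.kerIncl (proj₂ hg (𝒞.Δ (𝒞.kerIncl k))) =
      -𝒞.delta g (𝒞.kerIncl k) := by
  rw [incl_proj₂, 𝒞.counit_left, 𝒞.counit_right, counit_kerIncl, MulOpposite.op_zero, zero_smul,
    map_zero, AddMonoidHom.zero_apply, delta_apply]
  abel

theorem tpowMap_snoc₂ {M N : Bimod.{u, u, u} R R} (f : BimodHom M N) {n : ℕ} (x : tpow M n)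
    (z : Bimod.tensor M M) :
    tpowMap f (n + 2) (snoc₂ x z) = snoc₂ (tpowMap f n x) (Bimod.mapHom f f z) := by
  induction z using Bimod.tensor_induction with
  | tmul c c' => rfl
  | add z w hz hw => rw [map_add, map_add, map_add, map_add, hz, hw]

/-- The canonical map from the tensor powers of the kernel of the counit to those of `C`. -/
def incl (𝒞 : Coring R) (n : ℕ) : BimodHom (tpow 𝒞.kerCounit n) (tpow 𝒞.C n) := tpowMap 𝒞.kerIncl n

theorem amitsur_incl_mem {g : 𝒞.C} (hg : 𝒞.IsGrouplike g) (n : ℕ) (x : tpow 𝒞.kerCounit n) :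
    ∃ y, 𝒞.incl (n + 1) y = 𝒞.amitsur g n (𝒞.incl n x) := by
  induction n with
  | zero => exact ⟨snoc _ 0 (unitR _ 1) (dZero hg x), (𝒞.amitsur_unitR g x).symm⟩
  | succ n ih =>
    induction x using tpow_cases with
    | snoc x k =>
      obtain ⟨y, hy⟩ := ih x
      refine ⟨snoc _ (n + 1) y k - (-1 : ℤ) ^ n • snoc₂ x (proj₂ hg (𝒞.Δ (𝒞.kerIncl k))), ?_⟩
      have e : 𝒞.incl (n + 1) (snoc _ n x k) = snoc 𝒞.C n (𝒞.incl n x) (𝒞.kerIncl k) := rfl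
      rw [e, amitsur_snoc, ← hy, map_sub, map_zsmul]
      unfold incl
      rw [tpowMap_snoc, tpowMap_snoc₂, incl_proj₂_Δ, map_neg, smul_neg, sub_neg_eq_add]
    | add x y hx hy =>
      obtain ⟨x', hx⟩ := hx
      obtain ⟨y', hy⟩ := hy
      exact ⟨x' + y', by rw [map_add, map_add, map_add, hx, hy]⟩

end

/-- The map `c¹ ⊗ ⋯ ⊗ cⁿ ⊗ c ↦ c¹ ⊗ ⋯ ⊗ cⁿ ε(c)`. -/
def lastCounit (𝒞 : Coring R) (n : ℕ) : tpow 𝒞.C (n + 1) →+ tpow 𝒞.C n :=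
  snocLift ((AddMonoidHom.compHom.flip 𝒞.counit).comp (Bimod.rmul (tpow 𝒞.C n))) (fun x r c => by
    change op (𝒞.counit c) • op r • x = op (𝒞.counit (r • c)) • x
    rw [counit_smul, Bimod.op_op_smul])

theorem lastCounit_snoc {n : ℕ} (x : tpow 𝒞.C n) (c : 𝒞.C) :
    𝒞.lastCounit n (snoc 𝒞.C n x c) = op (𝒞.counit c) • x := rfl

end Coring

namespace Coring

variable {R : Type u} [Ring R] {𝒞 : Coring R}

/-- The right linear map `r ↦ g r`, `c¹ ⊗ ⋯ ⊗ cⁿ ↦ c¹ ⊗ ⋯ ⊗ Δ cⁿ`, a section of `lastCounit`. -/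
def coact {g : 𝒞.C} (hg : 𝒞.IsGrouplike g) : ∀ n, {f : tpow 𝒞.C n →+ tpow 𝒞.C (n + 1) //
    (∀ (r : R) x, f (op r • x) = op r • f x) ∧ ∀ x, 𝒞.lastCounit n (f x) = x}
  | 0 => ⟨(snoc 𝒞.C 0 (unitR 𝒞.C 1)).comp (Bimod.rmul 𝒞.C g),
      fun r x => congrArg (snoc 𝒞.C 0 (unitR 𝒞.C 1)) (Bimod.op_op_smul g (show R from x) r).symm,
      fun x => by
        change op (𝒞.counit (op (show R from x) • g)) • unitR 𝒞.C 1 = unitR 𝒞.C (show R from x)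
        rw [counit_op_smul, hg.counit, right_unitR, one_mul, one_mul]⟩
  | n + 1 => ⟨snocLift (𝒞.snocΔ n) (fun x r c => 𝒞.snocΔ_smul x r c), fun r x => by
        induction x using tpow_cases with
        | snoc x c => exact 𝒞.snocΔ_right x r c
        | add x y hx hy => rw [smul_add, map_add, map_add, hx, hy, smul_add], fun x => by
        induction x using tpow_cases with
        | snoc x c =>
          have key : ∀ z, 𝒞.lastCounit (n + 1) (snoc₂ x z) =
              snoc 𝒞.C n x (Bimod.rid 𝒞.C (Bimod.mapHom (Bimod.idHom 𝒞.C) 𝒞.ε z)) := by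
            intro z
            induction z using Bimod.tensor_induction with
            | tmul c c' => rfl
            | add z w hz hw => simp only [map_add, hz, hw]
          rw [snocLift_snoc, snocΔ_apply, key, 𝒞.counit_right]
        | add x y hx hy => rw [map_add, map_add, hx, hy]⟩

theorem lastCounit_right {n : ℕ} (r : R) (x : tpow 𝒞.C (n + 1)) :
    𝒞.lastCounit n (op r • x) = op r • 𝒞.lastCounit n x := by
  induction x using tpow_cases with
  | snoc x c =>
    rw [right_snoc, lastCounit_snoc, lastCounit_snoc, counit_op_smul, Bimod.op_op_smul]
  | add x y hx hy => rw [smul_add, map_add, map_add, hx, hy, smul_add]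

/-- The canonical maps `incl` have right linear retractions. -/
theorem exists_retract {g : 𝒞.C} (hg : 𝒞.IsGrouplike g) (n : ℕ) :
    ∃ f : tpow 𝒞.C n →+ tpow 𝒞.kerCounit n,
      (∀ (r : R) x, f (op r • x) = op r • f x) ∧ ∀ x, f (𝒞.incl n x) = x := by
  induction n with
  | zero => exact ⟨AddMonoidHom.id R, fun _ _ => rfl, fun _ => rfl⟩
  | succ n ih =>
    obtain ⟨f, hf, hi⟩ := ih
    obtain ⟨N, hN⟩ : ∃ N : tpow 𝒞.C (n + 1) →+ tpow 𝒞.kerCounit (n + 1), ∀ x c,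
        N (snoc 𝒞.C n x c) = snoc 𝒞.kerCounit n (f x) (projL hg c) :=
      ⟨Bimod.map f hf (projL hg) (projL_left hg), fun _ _ => rfl⟩
    have hr : ∀ (r : R) z, N (op r • z) = op r • N z +
        snoc 𝒞.kerCounit n (f (𝒞.lastCounit n z)) (dZero hg r) := by
      intro r z
      induction z using tpow_cases with
      | snoc x c =>
        rw [right_snoc, hN, hN, projL_right, map_add, lastCounit_snoc, hf, snoc_smul, right_snoc]
      | add x y hx hy =>
        simp only [smul_add, map_add, hx, hy, AddMonoidHom.add_apply]; abel
    refine ⟨N.comp (AddMonoidHom.id (tpow 𝒞.C (n + 1)) -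
      (coact hg n).1.comp (𝒞.lastCounit n)), fun r x => ?_, fun x => ?_⟩
    · have h : 𝒞.lastCounit n (x - (coact hg n).1 (𝒞.lastCounit n x)) = 0 := by
        rw [map_sub, (coact hg n).2.2, sub_self]
      simp only [AddMonoidHom.comp_apply, AddMonoidHom.sub_apply, AddMonoidHom.id_apply]
      rw [lastCounit_right, (coact hg n).2.1, ← smul_sub, hr, h, map_zero, map_zero,
        AddMonoidHom.zero_apply, add_zero]
    · induction x using tpow_cases with
      | snoc x k =>
        have e : 𝒞.incl (n + 1) (snoc _ n x k) = snoc 𝒞.C n (𝒞.incl n x) (𝒞.kerIncl k) := rfl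
        simp only [AddMonoidHom.comp_apply, AddMonoidHom.sub_apply, AddMonoidHom.id_apply]
        rw [e, lastCounit_snoc, counit_kerIncl, MulOpposite.op_zero, zero_smul, map_zero,
          sub_zero, hN, hi, projL_kerIncl]
      | add x y hx hy => rw [map_add, map_add, hx, hy]

theorem incl_injective {g : 𝒞.C} (hg : 𝒞.IsGrouplike g) (n : ℕ) :
    Function.Injective (𝒞.incl n) :=
  let ⟨f, _, hf⟩ := exists_retract hg n
  Function.LeftInverse.injective (g := f) hf

/-- The restriction of the Amitsur differential to the tensor powers of the kernel of the
counit, characterised by `incl_formsD`. -/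
def formsD {g : 𝒞.C} (hg : 𝒞.IsGrouplike g) (n : ℕ) :
    tpow 𝒞.kerCounit n →+ tpow 𝒞.kerCounit (n + 1) :=
  AddMonoidHom.mk' (fun x => Classical.choose (amitsur_incl_mem hg n x)) (fun x y => by
    apply incl_injective hg
    refine (Classical.choose_spec (amitsur_incl_mem hg n (x + y))).trans ?_
    rw [map_add (𝒞.incl (n + 1)), map_add (𝒞.incl n), map_add]
    exact congrArg₂ (· + ·) (Classical.choose_spec (amitsur_incl_mem hg n x)).symm
      (Classical.choose_spec (amitsur_incl_mem hg n y)).symm)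

theorem incl_formsD {g : 𝒞.C} (hg : 𝒞.IsGrouplike g) (n : ℕ) (x : tpow 𝒞.kerCounit n) :
    𝒞.incl (n + 1) (formsD hg n x) = 𝒞.amitsur g n (𝒞.incl n x) :=
  Classical.choose_spec (amitsur_incl_mem hg n x)

theorem incl_mul (m n : ℕ) (x : tpow 𝒞.kerCounit m) (y : tpow 𝒞.kerCounit n) :
    𝒞.incl (m + n) (tensMul m n x y) = tensMul m n (𝒞.incl m x) (𝒞.incl n y) :=
  tpowMap_mul 𝒞.kerIncl m n x y

theorem incl_gcast {m n : ℕ} (h : m = n) (x : tpow 𝒞.kerCounit m) :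
    𝒞.incl n (gcast (A := fun n => tpow 𝒞.kerCounit n) h x) =
      gcast (A := fun n => tpow 𝒞.C n) h (𝒞.incl m x) := by
  subst h; rfl

theorem formsD_mul {g : 𝒞.C} (hg : 𝒞.IsGrouplike g) (m n : ℕ) (x : tpow 𝒞.kerCounit m)
    (y : tpow 𝒞.kerCounit n) :
    formsD hg (m + n) (tensMul m n x y) =
      gcast (A := fun n => tpow 𝒞.kerCounit n) (Nat.succ_add m n)
        (tensMul (m + 1) n (formsD hg m x) y) +
      (-1 : ℤ) ^ m • tensMul m (n + 1) x (formsD hg n y) := by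
  apply incl_injective hg
  rw [incl_formsD, incl_mul, amitsur_mul, map_add, map_zsmul, incl_gcast, incl_mul, incl_formsD]
  refine congrArg₂ (· + ·) rfl (congrArg _ ?_)
  exact ((incl_mul m (n + 1) x (formsD hg n y)).trans (by rw [incl_formsD])).symm

end Coring

/-- The Leibniz rule in `⨁ Ωⁿ` from the Leibniz rule for homogeneous elements. -/
theorem leibniz_of_gcast {A : ℕ → Type u} [∀ n, AddCommGroup (A n)] [DirectSum.GRing A] {m n : ℕ}
    {x : A m} {y : A n} {x' : A (m + 1)} {y' : A (n + 1)} {z : A (m + n + 1)}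
    (h : z = gcast (Nat.succ_add m n) (GradedMonoid.GMul.mul x' y) +
      (-1 : ℤ) ^ m • (GradedMonoid.GMul.mul x y' : A (m + (n + 1)))) :
    DirectSum.of A (m + n + 1) z =
      DirectSum.of A (m + 1) x' * DirectSum.of A n y +
        (-1) ^ m * (DirectSum.of A m x * DirectSum.of A (n + 1) y') := by
  rw [h, map_add, of_gcast, DirectSum.of_mul_of, DirectSum.of_mul_of, map_zsmul]
  rcases Nat.even_or_odd m with hm | hm <;> simp [hm.neg_one_pow] <;> rfl

/-- A ring homomorphism into the degree zero component of a graded ring. -/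
def degZeroHom {S : Type v} [Ring S] {A : ℕ → Type u} [∀ n, AddCommGroup (A n)]
    [DirectSum.GRing A] (f : S →+ A 0) (h1 : f 1 = (GradedMonoid.GOne.one : A 0))
    (hm : ∀ s t, f (s * t) = (GradedMonoid.GMul.mul (f s) (f t) : A (0 + 0))) : S →+* A 0 :=
  { f with
    map_one' := h1
    map_mul' := hm }

/-- The `S`-relative differential graded ring `Ω(C/S)` of differential forms with values in the
`R`-coring `C` with a grouplike element `g`: the tensor ring of the `(R, R)`-bimodule `ker ε`,
with the restriction of the Amitsur differential. Here `S → R` is a ring map whose image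
centralises `g`. -/
def Coring.forms {S : Type v} [Ring S] {R : Type u} [Ring R] (φ : S →+* R) (𝒞 : Coring R)
    (g : 𝒞.C) (hg : 𝒞.IsGrouplike g) (hφ : ∀ s, φ s • g = op (φ s) • g) : RelDGRing.{u, v} S :=
  letI := tensorRing 𝒞.kerCounit
  { Ω := fun n => tpow 𝒞.kerCounit n
    d := Coring.formsD hg
    d_d := fun n x => Coring.incl_injective hg _ (by
      rw [Coring.incl_formsD, Coring.incl_formsD, Coring.amitsur_amitsur 𝒞 hg, map_zero])
    leibniz := fun m n x y => leibniz_of_gcast (Coring.formsD_mul hg m n x y)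
    η := degZeroHom (A := fun n => tpow 𝒞.kerCounit n)
      ((unitR 𝒞.kerCounit).comp φ.toAddMonoidHom)
      (congrArg (unitR 𝒞.kerCounit) (map_one φ))
      (fun s t => congrArg (unitR 𝒞.kerCounit) (map_mul φ s t))
    d_η := fun s => Coring.incl_injective hg _ (by
      rw [Coring.incl_formsD]
      refine (𝒞.amitsur_unitR g (φ s)).trans ?_
      rw [hφ, sub_self, map_zero, map_zero]) }

/-! ### The canonical coring of a ring extension -/

section Extension

variable {S : Type v} {R : Type u} [Ring S] [Ring R] (φ : S →+* R)

/-- `R` as an `(R, S)`-bimodule along `S → R`. -/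
def resRight : Bimod.{u, v, u} R S :=
  letI r : Module Sᵐᵒᵖ R := Module.compHom R φ.op
  { carrier := R
    right := r
    comm := ⟨fun a s x => smul_comm a (φ.op s) x⟩ }

/-- `R` as an `(S, R)`-bimodule along `S → R`. -/
def resLeft : Bimod.{v, u, u} S R :=
  letI l : Module S R := Module.compHom R φ
  { carrier := R
    left := l
    comm := ⟨fun s a x => smul_comm (φ s) a x⟩ }

/-- The `(R, R)`-bimodule `R ⊗_S R`. -/
def sweedlerBimod : Bimod.{u, u, u} R R := Bimod.tensor (resRight φ) (resLeft φ)

/-- The element `r ⊗ r'` of `R ⊗_S R`. -/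
def rtmul : R →+ R →+ sweedlerBimod φ := Bimod.tmul (resRight φ) (resLeft φ)

variable {φ}

theorem rtmul_smul (r : R) (s : S) (r' : R) : rtmul φ (r * φ s) r' = rtmul φ r (φ s * r') :=
  Bimod.tmul_smul (X := resRight φ) (Y := resLeft φ) r s r'

theorem left_rtmul (a r r' : R) : a • rtmul φ r r' = rtmul φ (a * r) r' := rfl

theorem right_rtmul (a r r' : R) : op a • rtmul φ r r' = rtmul φ r (r' * a) := rfl

@[elab_as_elim]
theorem sweedler_induction {p : sweedlerBimod φ → Prop} (z : sweedlerBimod φ)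
    (tmul : ∀ r r', p (rtmul φ r r')) (add : ∀ x y, p x → p y → p (x + y)) : p z :=
  Bimod.tensor_induction z tmul add

/-- Maps out of `R ⊗_S R`. -/
def rlift {P : Type*} [AddCommGroup P] (f : R →+ R →+ P)
    (hf : ∀ r (s : S) r', f (r * φ s) r' = f r (φ s * r')) : sweedlerBimod φ →+ P :=
  Bimod.lift (X := resRight φ) (Y := resLeft φ) f hf

theorem rlift_rtmul {P : Type*} [AddCommGroup P] (f : R →+ R →+ P)
    (hf : ∀ r (s : S) r', f (r * φ s) r' = f r (φ s * r')) (r r' : R) :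
    rlift f hf (rtmul φ r r') = f r r' := rfl

variable (φ)

/-- `Δ (r ⊗ r') = (r ⊗ 1) ⊗ (1 ⊗ r')`. -/
def sweedlerΔ : BimodHom (sweedlerBimod φ) (Bimod.tensor (sweedlerBimod φ) (sweedlerBimod φ)) where
  toAddMonoidHom := rlift
    (((Bimod.tmul (sweedlerBimod φ) (sweedlerBimod φ)).compl₂ (rtmul φ 1)).comp
      ((rtmul φ).flip 1)) (fun r s r' => by
      change Bimod.tmul (sweedlerBimod φ) (sweedlerBimod φ) (rtmul φ (r * φ s) 1) (rtmul φ 1 r') =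
        Bimod.tmul (sweedlerBimod φ) (sweedlerBimod φ) (rtmul φ r 1) (rtmul φ 1 (φ s * r'))
      rw [rtmul_smul, ← rtmul_smul 1 s r', mul_one, one_mul,
        show rtmul φ r (φ s) = op (φ s) • rtmul φ r 1 by rw [right_rtmul, one_mul],
        Bimod.tmul_smul, left_rtmul, mul_one])
  map_left a z := by
    change rlift _ _ (a • z) = a • rlift _ _ z
    induction z using sweedler_induction with
    | tmul r r' => rfl
    | add x y hx hy => rw [smul_add, map_add, map_add, hx, hy, smul_add]
  map_right a z := by
    change rlift _ _ (op a • z) = op a • rlift _ _ z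
    induction z using sweedler_induction with
    | tmul r r' => rfl
    | add x y hx hy => rw [smul_add, map_add, map_add, hx, hy, smul_add]

theorem sweedlerΔ_rtmul (r r' : R) : sweedlerΔ φ (rtmul φ r r') =
    Bimod.tmul (sweedlerBimod φ) (sweedlerBimod φ) (rtmul φ r 1) (rtmul φ 1 r') := rfl

/-- `ε (r ⊗ r') = r r'`. -/
def sweedlerε : BimodHom (sweedlerBimod φ) (Bimod.regular R) where
  toAddMonoidHom := rlift (P := R) AddMonoidHom.mul (fun r s r' => mul_assoc r (φ s) r')
  map_left a z := by
    change rlift (P := R) _ _ (a • z) = a * rlift (P := R) _ _ z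
    induction z using sweedler_induction with
    | tmul r r' => exact mul_assoc a r r'
    | add x y hx hy => rw [smul_add, map_add, map_add, hx, hy, mul_add]
  map_right a z := by
    change rlift (P := R) _ _ (op a • z) = rlift (P := R) _ _ z * a
    induction z using sweedler_induction with
    | tmul r r' => exact (mul_assoc r r' a).symm
    | add x y hx hy => rw [smul_add, map_add, map_add, hx, hy, add_mul]

/-- The canonical Sweedler coring `R ⊗_S R` of a ring extension `S → R`. -/
def sweedler : Coring R where
  C := sweedlerBimod φ
  Δ := sweedlerΔ φ
  ε := sweedlerε φ
  coassoc c := by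
    induction c using sweedler_induction with
    | tmul r r' => rfl
    | add x y hx hy => rw [map_add, map_add, map_add, map_add, hx, hy]
  counit_left c := by
    induction c using sweedler_induction with
    | tmul r r' =>
      change (r * 1) • rtmul φ 1 r' = rtmul φ r r'
      rw [left_rtmul, mul_one, mul_one]
    | add x y hx hy => rw [map_add, map_add, map_add, hx, hy]
  counit_right c := by
    induction c using sweedler_induction with
    | tmul r r' =>
      change op (1 * r') • rtmul φ r 1 = rtmul φ r r'
      rw [right_rtmul, one_mul, one_mul]
    | add x y hx hy => rw [map_add, map_add, map_add, hx, hy]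

/-- The grouplike element `1 ⊗ 1` of the Sweedler coring. -/
def sweedlerOne : (sweedler φ).C := rtmul φ 1 1

theorem sweedlerOne_isGrouplike : (sweedler φ).IsGrouplike (sweedlerOne φ) where
  comul := rfl
  counit := mul_one (1 : R)

theorem sweedlerOne_central (s : S) : φ s • sweedlerOne φ = op (φ s) • sweedlerOne φ := by
  change φ s • rtmul φ 1 1 = op (φ s) • rtmul φ 1 1
  rw [left_rtmul, right_rtmul, mul_one, one_mul]
  simpa using rtmul_smul (1 : R) s 1

/-- The `S`-relative differential graded ring of forms with values in the Sweedler coring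
`R ⊗_S R` with the grouplike element `1 ⊗ 1`. -/
def sweedlerForms : RelDGRing.{u, v} S :=
  (sweedler φ).forms φ (sweedlerOne φ) (sweedlerOne_isGrouplike φ) (sweedlerOne_central φ)

/-! ### Relative differential forms -/

/-- The image of `S → R`, as an additive subgroup. -/
def imageSub : AddSubgroup R := φ.toAddMonoidHom.range

/-- The map of `R / S` induced by an additive map of `R` preserving the image of `S`. -/
def quotMap (f : R →+ R) (hf : ∀ s, ∃ t, f (φ s) = φ t) : R ⧸ imageSub φ →+ R ⧸ imageSub φ :=
  QuotientAddGroup.map _ _ f (by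
    rintro _ ⟨s, rfl⟩
    obtain ⟨t, ht⟩ := hf s
    exact ⟨t, ht.symm⟩)

/-- The cokernel `R / S` of `S → R`, as an `(S, S)`-bimodule. -/
def cokerBimod : Bimod.{v, v, u} S S :=
  letI l : Module S (R ⧸ imageSub φ) :=
    { smul := fun s => quotMap φ (AddMonoidHom.mulLeft (φ s)) (fun t => ⟨s * t, by simp⟩)
      one_smul := by
        rintro ⟨x⟩; exact congrArg (QuotientAddGroup.mk (s := imageSub φ)) (show φ 1 * x = x by simp)
      mul_smul := by
        rintro s t ⟨x⟩
        exact congrArg (QuotientAddGroup.mk (s := imageSub φ))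
          (show φ (s * t) * x = φ s * (φ t * x) by simp [mul_assoc])
      smul_zero := fun s => map_zero (quotMap φ _ _)
      smul_add := fun s => map_add (quotMap φ _ _)
      add_smul := by
        rintro s t ⟨x⟩
        exact congrArg (QuotientAddGroup.mk (s := imageSub φ))
          (show φ (s + t) * x = φ s * x + φ t * x by simp [add_mul])
      zero_smul := by
        rintro ⟨x⟩; exact congrArg (QuotientAddGroup.mk (s := imageSub φ)) (show φ 0 * x = 0 by simp) }
  letI r : Module Sᵐᵒᵖ (R ⧸ imageSub φ) :=
    { smul := fun s => quotMap φ (AddMonoidHom.mulRight (φ s.unop)) (fun t => ⟨t * s.unop, by simp⟩)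
      one_smul := by
        rintro ⟨x⟩; exact congrArg (QuotientAddGroup.mk (s := imageSub φ)) (show x * φ 1 = x by simp)
      mul_smul := by
        rintro s t ⟨x⟩
        exact congrArg (QuotientAddGroup.mk (s := imageSub φ))
          (show x * φ (t.unop * s.unop) = x * φ t.unop * φ s.unop by simp [mul_assoc])
      smul_zero := fun s => map_zero (quotMap φ _ _)
      smul_add := fun s => map_add (quotMap φ _ _)
      add_smul := by
        rintro s t ⟨x⟩
        exact congrArg (QuotientAddGroup.mk (s := imageSub φ))
          (show x * φ (s.unop + t.unop) = x * φ s.unop + x * φ t.unop by simp [mul_add])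
      zero_smul := by
        rintro ⟨x⟩; exact congrArg (QuotientAddGroup.mk (s := imageSub φ)) (show x * φ 0 = 0 by simp) }
  { carrier := R ⧸ imageSub φ
    left := l
    right := r
    comm := ⟨by
      rintro s t ⟨x⟩
      exact congrArg (QuotientAddGroup.mk (s := imageSub φ))
        (show φ s * (x * φ t.unop) = φ s * x * φ t.unop by rw [mul_assoc])⟩ }

/-- The projection `π : R → R / S`. -/
def proj : R →+ cokerBimod φ := QuotientAddGroup.mk' (imageSub φ)

theorem proj_surjective : Function.Surjective (proj φ) := QuotientAddGroup.mk'_surjective _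

theorem proj_left (s : S) (r : R) : proj φ (φ s * r) = s • proj φ r := rfl

theorem proj_right (s : S) (r : R) : proj φ (r * φ s) = op s • proj φ r := rfl

theorem proj_image (s : S) : proj φ (φ s) = 0 :=
  (QuotientAddGroup.eq_zero_iff _).2 ⟨s, rfl⟩

theorem proj_one : proj φ 1 = 0 := by simpa using proj_image φ 1

/-- Maps out of `R / S`. -/
def projLift {P : Type*} [AddCommGroup P] (f : R →+ P) (hf : ∀ s, f (φ s) = 0) :
    cokerBimod φ →+ P :=
  QuotientAddGroup.lift (imageSub φ) f (by rintro _ ⟨s, rfl⟩; exact hf s)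

@[simp] theorem projLift_proj {P : Type*} [AddCommGroup P] (f : R →+ P) (hf : ∀ s, f (φ s) = 0)
    (r : R) : projLift φ f hf (proj φ r) = f r := rfl

/-- The `(R, S)`-bimodule `Ωⁿ_S R = R ⊗_S R/S ⊗_S ⋯ ⊗_S R/S` (`n` factors `R/S`). -/
def relPow : ℕ → Bimod.{u, v, u} R S
  | 0 => resRight φ
  | n + 1 => Bimod.tensor (relPow n) (cokerBimod φ)

/-- An element of `R` in degree zero. -/
def relUnit : R →+ relPow φ 0 := AddMonoidHom.id R

/-- `relSnoc w q` is `w ⊗ q`. -/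
def relSnoc (n : ℕ) : relPow φ n →+ cokerBimod φ →+ relPow φ (n + 1) :=
  Bimod.tmul (relPow φ n) (cokerBimod φ)

variable {φ}

theorem relSnoc_smul {n : ℕ} (w : relPow φ n) (s : S) (q : cokerBimod φ) :
    relSnoc φ n (op s • w) q = relSnoc φ n w (s • q) := Bimod.tmul_smul w s q

theorem right_relSnoc {n : ℕ} (w : relPow φ n) (s : S) (q : cokerBimod φ) :
    op s • relSnoc φ n w q = relSnoc φ n w (op s • q) := rfl

theorem right_relUnit (s : S) (r : R) : op s • relUnit φ r = relUnit φ (r * φ s) := rfl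

/-- Maps out of `relPow φ (n + 1)`. -/
def relLift {P : Type*} [AddCommGroup P] {n : ℕ} (f : relPow φ n →+ cokerBimod φ →+ P)
    (hf : ∀ w (s : S) q, f (op s • w) q = f w (s • q)) : relPow φ (n + 1) →+ P :=
  Bimod.lift f hf

@[simp] theorem relLift_relSnoc {P : Type*} [AddCommGroup P] {n : ℕ}
    (f : relPow φ n →+ cokerBimod φ →+ P) (hf : ∀ w (s : S) q, f (op s • w) q = f w (s • q))
    (w : relPow φ n) (q : cokerBimod φ) : relLift f hf (relSnoc φ n w q) = f w q := rfl

@[elab_as_elim]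
theorem relPow_cases {n : ℕ} {p : relPow φ (n + 1) → Prop} (z : relPow φ (n + 1))
    (snoc : ∀ w r, p (relSnoc φ n w (proj φ r))) (add : ∀ x y, p x → p y → p (x + y)) : p z :=
  Bimod.tensor_induction z (fun w q => by
    obtain ⟨r, rfl⟩ := proj_surjective φ q
    exact snoc w r) add

end Extension

section Relative

variable {S : Type v} {R : Type u} [Ring S] [Ring R] {φ : S →+* R}

/-- The three properties of a right multiplication `W × R → W` compatible with `S`. -/
structure IsRelAct {n : ℕ} (f : relPow φ n →+ R →+ relPow φ n) : Prop where
  image : ∀ w s, f w (φ s) = op s • w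
  smul : ∀ w s a, f (op s • w) a = f w (φ s * a)
  mul : ∀ w a s, f w (a * φ s) = op s • f w a

/-- The map `(w, a, r) ↦ w ⊗ π(a r) - f(w, a) ⊗ π(r)`. -/
def relActPre {n : ℕ} (f : relPow φ n →+ R →+ relPow φ n) (w : relPow φ n) :
    R →+ R →+ relPow φ (n + 1) :=
  AddMonoidHom.mul.compr₂ ((relSnoc φ n w).comp (proj φ)) -
    ((relSnoc φ n).compl₂ (proj φ)).comp (f w)

theorem relActPre_apply {n : ℕ} (f : relPow φ n →+ R →+ relPow φ n) (w : relPow φ n) (a r : R) :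
    relActPre f w a r = relSnoc φ n w (proj φ (a * r)) - relSnoc φ n (f w a) (proj φ r) := rfl

/-- The map `(w ⊗ π(a), r) ↦ w ⊗ π(a r) - f(w, a) ⊗ π(r)`. -/
def relActStep {n : ℕ} (f : relPow φ n →+ R →+ relPow φ n) (hf : IsRelAct f) :
    relPow φ (n + 1) →+ R →+ relPow φ (n + 1) :=
  relLift (AddMonoidHom.mk' (fun w => projLift φ (relActPre f w) (fun s => by
      ext r
      rw [relActPre_apply, hf.image, relSnoc_smul, proj_left, sub_self]; rfl))
    (fun w w' => by
      ext q r
      obtain ⟨a, rfl⟩ := proj_surjective φ q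
      simp only [AddMonoidHom.add_apply, projLift_proj, relActPre_apply, map_add]
      abel))
    (fun w s q => by
      obtain ⟨a, rfl⟩ := proj_surjective φ q
      ext r
      change relActPre f (op s • w) a r = relActPre f w (φ s * a) r
      rw [relActPre_apply, relActPre_apply, relSnoc_smul, hf.smul, mul_assoc, proj_left])

theorem relActStep_apply {n : ℕ} (f : relPow φ n →+ R →+ relPow φ n) (hf : IsRelAct f)
    (w : relPow φ n) (a r : R) : relActStep f hf (relSnoc φ n w (proj φ a)) r =
      relSnoc φ n w (proj φ (a * r)) - relSnoc φ n (f w a) (proj φ r) := rfl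

theorem relActStep_isRelAct {n : ℕ} (f : relPow φ n →+ R →+ relPow φ n) (hf : IsRelAct f) :
    IsRelAct (relActStep f hf) where
  image w s := by
    induction w using relPow_cases with
    | snoc w a =>
      rw [relActStep_apply, proj_image, map_zero, sub_zero, proj_right, right_relSnoc]
    | add x y hx hy => rw [map_add, AddMonoidHom.add_apply, hx, hy, smul_add]
  smul w s r := by
    induction w using relPow_cases with
    | snoc w a =>
      rw [right_relSnoc, ← proj_right, relActStep_apply, relActStep_apply, hf.mul, relSnoc_smul,
        proj_left, mul_assoc]
    | add x y hx hy =>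
      rw [smul_add, map_add, map_add, AddMonoidHom.add_apply, AddMonoidHom.add_apply, hx, hy]
  mul w r s := by
    induction w using relPow_cases with
    | snoc w a =>
      rw [relActStep_apply, relActStep_apply, smul_sub, right_relSnoc, right_relSnoc, ← proj_right,
        ← proj_right, mul_assoc]
    | add x y hx hy => rw [map_add, AddMonoidHom.add_apply, AddMonoidHom.add_apply, hx, hy, smul_add]

/-- Multiplication by `R` from the right, with its properties. -/
def relActAux (φ : S →+* R) : ∀ n, {f : relPow φ n →+ R →+ relPow φ n // IsRelAct f}
  | 0 => ⟨(AddMonoidHom.mul : R →+ R →+ R),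
      ⟨fun _ _ => rfl, fun w s a => mul_assoc (show R from w) (φ s) a,
        fun w a s => (mul_assoc (show R from w) a (φ s)).symm⟩⟩
  | n + 1 => ⟨relActStep (relActAux φ n).1 (relActAux φ n).2,
      relActStep_isRelAct (relActAux φ n).1 (relActAux φ n).2⟩

/-- Multiplication of relative forms by elements of `R` from the right: in degree zero it is the
product of `R`, and `(w ⊗ π(a)) r = w ⊗ π(a r) - (w a) ⊗ π(r)`. Unfolding the recursion gives
`(r₀, …, rₙ) r = ∑ᵢ (-1)ⁿ⁻ⁱ (r₀, …, rᵢ rᵢ₊₁, …, rₙ, r)` with `rₙ₊₁ = r`. -/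
def relAct (φ : S →+* R) (n : ℕ) : relPow φ n →+ R →+ relPow φ n := (relActAux φ n).1

theorem relAct_isRelAct (n : ℕ) : IsRelAct (relAct φ n) := (relActAux φ n).2

theorem relAct_relUnit (a r : R) : relAct φ 0 (relUnit φ a) r = relUnit φ (a * r) := rfl

theorem relAct_relSnoc {n : ℕ} (w : relPow φ n) (a r : R) :
    relAct φ (n + 1) (relSnoc φ n w (proj φ a)) r =
      relSnoc φ n w (proj φ (a * r)) - relSnoc φ n (relAct φ n w a) (proj φ r) := rfl

theorem relAct_one {n : ℕ} (w : relPow φ n) : relAct φ n w 1 = w := by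
  rw [← map_one φ, (relAct_isRelAct n).image, MulOpposite.op_one, one_smul]

theorem relAct_mul {n : ℕ} (w : relPow φ n) (a b : R) :
    relAct φ n w (a * b) = relAct φ n (relAct φ n w a) b := by
  induction n generalizing a b with
  | zero => exact (mul_assoc (show R from w) a b).symm
  | succ n ih =>
    induction w using relPow_cases with
    | snoc w c =>
      rw [relAct_relSnoc, relAct_relSnoc, map_sub, AddMonoidHom.sub_apply, relAct_relSnoc,
        relAct_relSnoc, ih, mul_assoc]
      abel
    | add x y hx hy =>
      simp only [map_add, AddMonoidHom.add_apply, hx, hy]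

/-- The map `(x, w ⊗ q) ↦ f (x, w) ⊗ q`. -/
def relStep {P : Type*} [AddCommGroup P] {n k : ℕ} (f : P →+ relPow φ n →+ relPow φ k)
    (hf : ∀ x (s : S) w, f x (op s • w) = op s • f x w) :
    P →+ relPow φ (n + 1) →+ relPow φ (k + 1) :=
  AddMonoidHom.mk' (fun x => relLift ((relSnoc φ k).comp (f x))
    (fun w s q => by simp only [AddMonoidHom.comp_apply, hf]; exact relSnoc_smul _ _ _))
    (fun x y => Bimod.tensor_ext fun w q => by
      change relSnoc φ k (f (x + y) w) q = relSnoc φ k (f x w) q + relSnoc φ k (f y w) q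
      simp only [map_add, AddMonoidHom.add_apply])

theorem relStep_right {P : Type*} [AddCommGroup P] {n k : ℕ} (f : P →+ relPow φ n →+ relPow φ k)
    (hf : ∀ x (s : S) w, f x (op s • w) = op s • f x w) (x : P) (s : S) (w : relPow φ (n + 1)) :
    relStep f hf x (op s • w) = op s • relStep f hf x w := by
  induction w using relPow_cases with
  | snoc w r => rfl
  | add y z hy hz => rw [smul_add, map_add, map_add, hy, hz, smul_add]

/-- Multiplication of relative forms, with its right linearity. -/
def relMulAux (φ : S →+* R) (m : ℕ) : ∀ n, {f : relPow φ m →+ relPow φ n →+ relPow φ (m + n) //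
    ∀ x (s : S) w, f x (op s • w) = op s • f x w}
  | 0 => ⟨relAct φ m, fun x s w => (relAct_isRelAct m).mul x (show R from w) s⟩
  | n + 1 => ⟨relStep (relMulAux φ m n).1 (relMulAux φ m n).2,
      relStep_right (relMulAux φ m n).1 (relMulAux φ m n).2⟩

/-- Multiplication of relative forms: `w (r ⊗ q₁ ⊗ ⋯ ⊗ qₙ) = (w r) ⊗ q₁ ⊗ ⋯ ⊗ qₙ`. On pure
tensors this is the alternating sum of `relMul_relPure`. -/
def relMul (φ : S →+* R) (m n : ℕ) : relPow φ m →+ relPow φ n →+ relPow φ (m + n) := (relMulAux φ m n).1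

theorem relMul_relUnit {m : ℕ} (x : relPow φ m) (r : R) :
    relMul φ m 0 x (relUnit φ r) = relAct φ m x r := rfl

theorem relMul_relSnoc {m n : ℕ} (x : relPow φ m) (w : relPow φ n) (q : cokerBimod φ) :
    relMul φ m (n + 1) x (relSnoc φ n w q) = relSnoc φ (m + n) (relMul φ m n x w) q := rfl

theorem relMul_relAct {m n : ℕ} (x : relPow φ m) (w : relPow φ n) (r : R) :
    relMul φ m n x (relAct φ n w r) = relAct φ (m + n) (relMul φ m n x w) r := by
  induction n generalizing r with
  | zero => exact relAct_mul x (show R from w) r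
  | succ n ih =>
    induction w using relPow_cases with
    | snoc w a =>
      rw [relAct_relSnoc, map_sub, relMul_relSnoc, relMul_relSnoc, ih, relMul_relSnoc]
      exact (relAct_relSnoc (relMul φ m n x w) a r).symm
    | add y z hy hz =>
      simp only [map_add, AddMonoidHom.add_apply, hy, hz]

theorem gcast_relSnoc {m n : ℕ} (h : m = n) (x : relPow φ m) (q : cokerBimod φ) :
    gcast (A := fun n => relPow φ n) (congrArg (· + 1) h) (relSnoc φ m x q) =
      relSnoc φ n (gcast (A := fun n => relPow φ n) h x) q := by
  subst h; rfl

theorem relUnit_relMul (n : ℕ) (x : relPow φ n) :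
    gcast (A := fun n => relPow φ n) (Nat.zero_add n) (relMul φ 0 n (relUnit φ 1) x) = x := by
  induction n with
  | zero => exact one_mul (M := R) x
  | succ n ih =>
    induction x using relPow_cases with
    | snoc x r =>
      rw [relMul_relSnoc]
      exact (gcast_relSnoc (Nat.zero_add n) _ (proj φ r)).trans (by rw [ih])
    | add x y hx hy => rw [map_add, map_add, hx, hy]

theorem relMul_assoc (l m n : ℕ) (x : relPow φ l) (y : relPow φ m) (z : relPow φ n) :
    gcast (A := fun n => relPow φ n) (Nat.add_assoc l m n) (relMul φ _ _ (relMul φ _ _ x y) z) =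
      relMul φ _ _ x (relMul φ _ _ y z) := by
  induction n with
  | zero => exact (relMul_relAct x y (show R from z)).symm
  | succ n ih =>
    induction z using relPow_cases with
    | snoc z r =>
      rw [relMul_relSnoc, relMul_relSnoc]
      exact (gcast_relSnoc (Nat.add_assoc l m n) _ (proj φ r)).trans (by rw [ih]; rfl)
    | add z w hz hw => rw [map_add, map_add, hz, hw, map_add, map_add]

/-- The graded ring of relative forms. -/
@[reducible] def relRing (φ : S →+* R) : DirectSum.GRing (fun n => relPow φ n) :=
  gringMk (relMul φ) (relUnit φ 1) relUnit_relMul (fun _ x => relAct_one x) relMul_assoc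

/-- The differential of relative forms, with its right linearity. -/
def relDAux (φ : S →+* R) : ∀ n, {f : relPow φ n →+ relPow φ (n + 1) // ∀ (s : S) w, f (op s • w) = op s • f w}
  | 0 => ⟨(relSnoc φ 0 (relUnit φ 1)).comp (proj φ), fun _ _ => rfl⟩
  | n + 1 => ⟨relLift ((relSnoc φ (n + 1)).comp (relDAux φ n).1) (fun w s q => by
        simp only [AddMonoidHom.comp_apply, (relDAux φ n).2]
        exact relSnoc_smul _ _ _), fun s w => by
      induction w using relPow_cases with
      | snoc w r => rfl
      | add y z hy hz => rw [smul_add, map_add, map_add, hy, hz, smul_add]⟩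

/-- The differential `d (r₀ ⊗ q₁ ⊗ ⋯ ⊗ qₙ) = 1 ⊗ π(r₀) ⊗ q₁ ⊗ ⋯ ⊗ qₙ`. -/
def relD (φ : S →+* R) (n : ℕ) : relPow φ n →+ relPow φ (n + 1) := (relDAux φ n).1

theorem relD_relUnit (r : R) : relD φ 0 (relUnit φ r) = relSnoc φ 0 (relUnit φ 1) (proj φ r) := rfl

theorem relD_relSnoc {n : ℕ} (w : relPow φ n) (q : cokerBimod φ) :
    relD φ (n + 1) (relSnoc φ n w q) = relSnoc φ (n + 1) (relD φ n w) q := rfl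

theorem relD_relD (n : ℕ) (w : relPow φ n) : relD φ (n + 1) (relD φ n w) = 0 := by
  induction n with
  | zero =>
    change relD φ 1 (relSnoc φ 0 (relUnit φ 1) (proj φ (show R from w))) = 0
    rw [relD_relSnoc, relD_relUnit, proj_one, map_zero, map_zero]; rfl
  | succ n ih =>
    induction w using relPow_cases with
    | snoc w r => rw [relD_relSnoc, relD_relSnoc, ih, map_zero]; rfl
    | add y z hy hz => rw [map_add, map_add, hy, hz, add_zero]

theorem relD_relAct {n : ℕ} (w : relPow φ n) (r : R) :
    relD φ n (relAct φ n w r) =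
      relAct φ (n + 1) (relD φ n w) r + (-1 : ℤ) ^ n • relSnoc φ n w (proj φ r) := by
  induction n generalizing r with
  | zero =>
    change relSnoc φ 0 (relUnit φ 1) (proj φ ((show R from w) * r)) =
      relAct φ 1 (relSnoc φ 0 (relUnit φ 1) (proj φ (show R from w))) r + (1 : ℤ) • _
    rw [relAct_relSnoc, relAct_relUnit, one_mul, one_smul]
    exact (sub_add_cancel _ _).symm
  | succ n ih =>
    induction w using relPow_cases with
    | snoc w a =>
      rw [relAct_relSnoc, map_sub, relD_relSnoc, relD_relSnoc, relD_relSnoc, relAct_relSnoc, ih]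
      simp only [map_add, map_zsmul, AddMonoidHom.add_apply, AddMonoidHom.zsmul_apply, pow_succ,
        mul_neg, mul_one, neg_smul]
      abel
    | add y z hy hz =>
      simp only [map_add, AddMonoidHom.add_apply, hy, hz, smul_add]
      abel

theorem relD_mul (m n : ℕ) (x : relPow φ m) (y : relPow φ n) :
    relD φ (m + n) (relMul φ m n x y) =
      gcast (A := fun n => relPow φ n) (Nat.succ_add m n) (relMul φ (m + 1) n (relD φ m x) y) +
      (-1 : ℤ) ^ m • relMul φ m (n + 1) x (relD φ n y) := by
  induction n with
  | zero =>
    refine (relD_relAct x (show R from y)).trans ?_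
    have h : relMul φ m 1 x (relD φ 0 y) = relSnoc φ m x (proj φ (show R from y)) := by
      change relSnoc φ m (relAct φ m x 1) (proj φ (show R from y)) = _
      rw [relAct_one]
    exact congrArg (relAct φ (m + 1) (relD φ m x) (show R from y) + (-1 : ℤ) ^ m • ·) h.symm
  | succ n ih =>
    induction y using relPow_cases with
    | snoc y r =>
      rw [relMul_relSnoc, relMul_relSnoc, relD_relSnoc]
      refine (relD_relSnoc (relMul φ m n x y) (proj φ r)).trans ?_
      rw [ih, map_add, AddMonoidHom.add_apply, map_zsmul, AddMonoidHom.zsmul_apply]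
      exact congrArg₂ (· + ·) (gcast_relSnoc (Nat.succ_add m n) _ (proj φ r)).symm rfl
    | add y z hy hz =>
      simp only [map_add, smul_add]
      refine (congrArg₂ (· + ·) hy hz).trans ?_
      exact add_add_add_comm _ _ _ _

/-- The pure tensor `(r₀, r₁, …, rₙ) = r₀ ⊗ π(r₁) ⊗ ⋯ ⊗ π(rₙ)`. -/
def relPure (φ : S →+* R) (r : ℕ → R) : ∀ n, relPow φ n
  | 0 => relUnit φ (r 0)
  | n + 1 => relSnoc φ n (relPure φ r n) (proj φ (r (n + 1)))

/-- The sequence `(r₀, …, rᵢ rᵢ₊₁, rᵢ₊₂, …)`. -/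
def contract (r : ℕ → R) (i j : ℕ) : R :=
  if j < i then r j else if j = i then r i * r (i + 1) else r (j + 1)

theorem relPure_congr {r r' : ℕ → R} {n : ℕ} (h : ∀ j ≤ n, r j = r' j) :
    relPure φ r n = relPure φ r' n := by
  induction n with
  | zero => exact congrArg (relUnit φ) (h 0 le_rfl)
  | succ n ih =>
    rw [relPure, relPure, ih (fun j hj => h j (hj.trans n.le_succ)), h (n + 1) le_rfl]

theorem relAct_relPure (r : ℕ → R) (n : ℕ) :
    relAct φ n (relPure φ r n) (r (n + 1)) =
      ∑ i ∈ Finset.range (n + 1), (-1 : ℤ) ^ (n - i) • relPure φ (contract r i) n := by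
  induction n with
  | zero => simp [relPure, relAct_relUnit, contract]
  | succ n ih =>
    rw [relPure, relAct_relSnoc, ih, Finset.sum_range_succ _ (n + 1), Nat.sub_self, pow_zero,
      one_smul, sub_eq_add_neg]
    refine (add_comm _ _).trans (congrArg₂ (· + ·) ?_ ?_)
    rotate_left
    · rw [relPure, relPure_congr (r := contract r (n + 1)) (r' := r)]
      · simp [contract]
      · intro j hj
        simp [contract, Nat.lt_succ_of_le hj]
    · rw [map_sum, AddMonoidHom.finsetSum_apply, ← Finset.sum_neg_distrib]
      refine Finset.sum_congr rfl fun i hi => ?_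
      have hi' : i ≤ n := Nat.lt_succ_iff.1 (Finset.mem_range.1 hi)
      have h : contract r i (n + 1) = r (n + 2) := by
        unfold contract
        rw [if_neg (by omega), if_neg (by omega)]
      rw [map_zsmul, AddMonoidHom.zsmul_apply, relPure, h, Nat.succ_sub hi', pow_succ, mul_neg,
        mul_one, neg_smul]

/-- The product of pure tensors:
`(r₀, …, rₙ) (rₙ₊₁, …, rₙ₊₁₊ₘ) = ∑ᵢ (-1)ⁿ⁻ⁱ (r₀, …, rᵢ rᵢ₊₁, …, rₙ₊₁₊ₘ)`, over `0 ≤ i ≤ n`. -/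
theorem relMul_relPure (r : ℕ → R) (n m : ℕ) :
    relMul φ n m (relPure φ r n) (relPure φ (fun j => r (n + 1 + j)) m) =
      ∑ i ∈ Finset.range (n + 1), (-1 : ℤ) ^ (n - i) • relPure φ (contract r i) (n + m) := by
  induction m with
  | zero => exact relAct_relPure r n
  | succ m ih =>
    rw [relPure, relMul_relSnoc, ih, map_sum, AddMonoidHom.finsetSum_apply]
    refine Finset.sum_congr rfl fun i hi => ?_
    have hi' : i ≤ n := Nat.lt_succ_iff.1 (Finset.mem_range.1 hi)
    have h : contract r i (n + m + 1) = r (n + 1 + (m + 1)) := by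
      unfold contract
      rw [if_neg (by omega), if_neg (by omega)]
      congr 1; omega
    rw [map_zsmul, AddMonoidHom.zsmul_apply, ← h]
    rfl

/-- The differential of a pure tensor: `d (r₀, …, rₙ) = (1, r₀, …, rₙ)`. -/
theorem relD_relPure (r : ℕ → R) (n : ℕ) :
    relD φ n (relPure φ r n) = relPure φ (fun j => if j = 0 then 1 else r (j - 1)) (n + 1) := by
  induction n with
  | zero => rfl
  | succ n ih => rw [relPure, relD_relSnoc, ih]; rfl

/-- The `S`-relative differential graded ring `Ω_S R` of relative differential forms of a ring
extension `S → R`. -/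
def relForms (φ : S →+* R) : RelDGRing.{u, v} S :=
  letI := relRing φ
  { Ω := fun n => relPow φ n
    d := relD φ
    d_d := relD_relD
    leibniz := fun m n x y => leibniz_of_gcast (relD_mul m n x y)
    η := degZeroHom (A := fun n => relPow φ n)
      ((relUnit φ).comp φ.toAddMonoidHom)
      (congrArg (relUnit φ) (map_one φ))
      (fun s t => congrArg (relUnit φ) (map_mul φ s t))
    d_η := fun s => by
      change relSnoc φ 0 (relUnit φ 1) (proj φ (φ s)) = 0
      rw [proj_image, map_zero] }

end Relative

end CoringForms

end

/-!
A ring map `f : R → Γ⁰` under `S` into a relative differential graded ring `Γ` extends to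
`Ω_S R → Γ`, `(r₀, …, rₙ) ↦ f(r₀) d(f r₁) ⋯ d(f rₙ)`: the Leibniz rule for `d(f(a b))` is precisely
the alternating sum defining the product of `Ω_S R`. Applied to `R = Ω⁰(C/S)` this yields
`Ω_S R → Ω(C/S)` for any coring `C` with a grouplike `g` centralised by `S`, sending `w ⊗ π(r)` to
`w ⊗ (g r - r g)`. For the Sweedler coring, `a ⊗ b ↦ a ⊗ π(b)` identifies `ker ε` with `R ⊗_S R/S`,
so that `X ⊗_R ker ε ≅ X ⊗_S R/S` for every right `R`-module `X`, and bijectivity follows by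
induction on the degree.
-/

noncomputable section

namespace CoringForms

universe u v w

open scoped DirectSum

namespace RelDGRing

variable {S : Type v} [Ring S] {A : RelDGRing.{u, v} S} {B : RelDGRing.{w, v} S}

/-- A homomorphism of `S`-relative differential graded rings, given degree by degree as in
`RelDGRing.Iso`. -/
structure Hom (A : RelDGRing.{u, v} S) (B : RelDGRing.{w, v} S) where
  app : ∀ n, A.Ω n →+ B.Ω n
  map_mul : ∀ m n (x : A.Ω m) (y : A.Ω n),
    app (m + n) (GradedMonoid.GMul.mul x y) = GradedMonoid.GMul.mul (app m x) (app n y)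
  map_one : app 0 GradedMonoid.GOne.one = GradedMonoid.GOne.one
  map_d : ∀ n (x : A.Ω n), app (n + 1) (A.d n x) = B.d n (app n x)
  map_η : ∀ s, app 0 (A.η s) = B.η s

/-- The isomorphism given by a homomorphism that is bijective in every degree. -/
def Hom.isoOfBijective (f : Hom A B) (hf : ∀ n, Function.Bijective (f.app n)) : Iso A B where
  equiv n := AddEquiv.ofBijective (f.app n) (hf n)
  map_mul := f.map_mul
  map_one := f.map_one
  map_d := f.map_d
  map_η := f.map_η

/-- The inverse isomorphism. -/
def Iso.symm (e : Iso A B) : Iso B A where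
  equiv n := (e.equiv n).symm
  map_mul m n x y := by
    rw [AddEquiv.symm_apply_eq, e.map_mul, AddEquiv.apply_symm_apply, AddEquiv.apply_symm_apply]
  map_one := by rw [AddEquiv.symm_apply_eq, e.map_one]
  map_d n x := by rw [AddEquiv.symm_apply_eq, e.map_d, AddEquiv.apply_symm_apply]
  map_η s := by rw [AddEquiv.symm_apply_eq, e.map_η]

theorem D_D_of (n : ℕ) (x : A.Ω n) : A.D (A.D (DirectSum.of A.Ω n x)) = 0 := by
  rw [D_of, D_of, A.d_d, map_zero]

end RelDGRing

section UniversalProperty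

variable {S : Type v} {R : Type u} [Ring S] [Ring R] {φ : S →+* R} {Γ : RelDGRing.{w, v} S}
  (f : R →+* Γ.Ω 0)

theorem D_of_map_mul (a b : R) :
    Γ.D (DirectSum.of Γ.Ω 0 (f (a * b))) =
      Γ.D (DirectSum.of Γ.Ω 0 (f a)) * DirectSum.of Γ.Ω 0 (f b) +
        DirectSum.of Γ.Ω 0 (f a) * Γ.D (DirectSum.of Γ.Ω 0 (f b)) := by
  rw [map_mul, DirectSum.of_zero_mul, Γ.D_mul, pow_zero, one_mul]

variable (hf : ∀ s, f (φ s) = Γ.η s)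

/-- The map `π(r) ↦ d (f r)`, well defined since `d` vanishes on the image of `S`. -/
def cokerD : cokerBimod φ →+ Γ.Ω 1 :=
  projLift φ ((Γ.d 0).comp f.toAddMonoidHom) fun s => by
    change Γ.d 0 (f (φ s)) = 0
    rw [hf, Γ.d_η]

theorem of_cokerD_proj (r : R) :
    DirectSum.of Γ.Ω 1 (cokerD f hf (proj φ r)) = Γ.D (DirectSum.of Γ.Ω 0 (f r)) :=
  (Γ.D_of 0 (f r)).symm

theorem of_cokerD_smul (s : S) (q : cokerBimod φ) :
    DirectSum.of Γ.Ω 1 (cokerD f hf (s • q)) =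
      DirectSum.of Γ.Ω 0 (Γ.η s) * DirectSum.of Γ.Ω 1 (cokerD f hf q) := by
  obtain ⟨r, rfl⟩ := proj_surjective φ q
  rw [← proj_left, of_cokerD_proj, of_cokerD_proj, map_mul, hf, DirectSum.of_zero_mul, Γ.D_left]

theorem of_cokerD_op_smul (s : S) (q : cokerBimod φ) :
    DirectSum.of Γ.Ω 1 (cokerD f hf (op s • q)) =
      DirectSum.of Γ.Ω 1 (cokerD f hf q) * DirectSum.of Γ.Ω 0 (Γ.η s) := by
  obtain ⟨r, rfl⟩ := proj_surjective φ q
  rw [← proj_right, of_cokerD_proj, of_cokerD_proj, map_mul, hf, DirectSum.of_zero_mul, Γ.D_right]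

/-- The map `relExtend` bundled with its right `S`-linearity, which makes the next step of the
recursion balanced over `S`. -/
def relExtendAux : ∀ n, {F : relPow φ n →+ Γ.Ω n // ∀ (s : S) w,
    DirectSum.of Γ.Ω n (F (op s • w)) = DirectSum.of Γ.Ω n (F w) * DirectSum.of Γ.Ω 0 (Γ.η s)}
  | 0 => ⟨f.toAddMonoidHom, fun s w => by
      rw [← hf, ← DirectSum.of_zero_mul]
      exact congrArg _ (map_mul f (show R from w) (φ s))⟩
  | n + 1 => ⟨relLift (((DirectSum.gMulHom Γ.Ω).compl₂ (cokerD f hf)).comp (relExtendAux n).1)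
      (fun w s q => DirectSum.of_injective (β := Γ.Ω) (n + 1) (by
        change DirectSum.of Γ.Ω (n + 1) (GradedMonoid.GMul.mul _ _) =
          DirectSum.of Γ.Ω (n + 1) (GradedMonoid.GMul.mul _ _)
        rw [← DirectSum.of_mul_of, ← DirectSum.of_mul_of, (relExtendAux n).2, of_cokerD_smul,
          mul_assoc])), fun s w => by
      induction w using relPow_cases with
      | snoc w r =>
        change DirectSum.of Γ.Ω (n + 1)
            (GradedMonoid.GMul.mul ((relExtendAux n).1 w) (cokerD f hf (op s • proj φ r))) =
          DirectSum.of Γ.Ω (n + 1)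
            (GradedMonoid.GMul.mul ((relExtendAux n).1 w) (cokerD f hf (proj φ r))) * _
        rw [← DirectSum.of_mul_of, ← DirectSum.of_mul_of, of_cokerD_op_smul, mul_assoc]
      | add x y hx hy => simp only [smul_add, map_add, hx, hy, add_mul]⟩

/-- The extension `(r₀, …, rₙ) ↦ f(r₀) d(f r₁) ⋯ d(f rₙ)` to relative forms of a ring map `f` into
the degree zero component of an `S`-relative differential graded ring. -/
def relExtend (n : ℕ) : relPow φ n →+ Γ.Ω n := (relExtendAux f hf n).1

theorem relExtend_relUnit (r : R) : relExtend f hf 0 (relUnit φ r) = f r := rfl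

theorem relExtend_relSnoc {n : ℕ} (w : relPow φ n) (q : cokerBimod φ) :
    relExtend f hf (n + 1) (relSnoc φ n w q) =
      GradedMonoid.GMul.mul (relExtend f hf n w) (cokerD f hf q) := rfl

theorem relExtend_op_smul {n : ℕ} (w : relPow φ n) (s : S) :
    DirectSum.of Γ.Ω n (relExtend f hf n (op s • w)) =
      DirectSum.of Γ.Ω n (relExtend f hf n w) * DirectSum.of Γ.Ω 0 (Γ.η s) :=
  (relExtendAux f hf n).2 s w

theorem of_relExtend_relSnoc {n : ℕ} (w : relPow φ n) (r : R) :
    DirectSum.of Γ.Ω (n + 1) (relExtend f hf (n + 1) (relSnoc φ n w (proj φ r))) =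
      DirectSum.of Γ.Ω n (relExtend f hf n w) * Γ.D (DirectSum.of Γ.Ω 0 (f r)) := by
  rw [relExtend_relSnoc, ← of_cokerD_proj f hf, DirectSum.of_mul_of]

theorem of_relExtend_relAct {n : ℕ} (w : relPow φ n) (r : R) :
    DirectSum.of Γ.Ω n (relExtend f hf n (relAct φ n w r)) =
      DirectSum.of Γ.Ω n (relExtend f hf n w) * DirectSum.of Γ.Ω 0 (f r) := by
  induction n generalizing r with
  | zero =>
    rw [← DirectSum.of_zero_mul]
    exact congrArg _ (map_mul f (show R from w) r)
  | succ n ih =>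
    induction w using relPow_cases with
    | snoc w a =>
      rw [relAct_relSnoc, map_sub, map_sub, of_relExtend_relSnoc, of_relExtend_relSnoc,
        of_relExtend_relSnoc, ih, D_of_map_mul, mul_add, mul_assoc, mul_assoc, add_sub_cancel_right]
    | add x y hx hy => simp only [map_add, AddMonoidHom.add_apply, hx, hy, add_mul]

theorem of_relExtend_relMul {m n : ℕ} (x : relPow φ m) (y : relPow φ n) :
    DirectSum.of Γ.Ω (m + n) (relExtend f hf (m + n) (relMul φ m n x y)) =
      DirectSum.of Γ.Ω m (relExtend f hf m x) * DirectSum.of Γ.Ω n (relExtend f hf n y) := by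
  induction n with
  | zero => exact of_relExtend_relAct f hf x (show R from y)
  | succ n ih =>
    induction y using relPow_cases with
    | snoc y r =>
      rw [relMul_relSnoc, of_relExtend_relSnoc, ← mul_assoc, ← ih]
      exact of_relExtend_relSnoc f hf (relMul φ m n x y) r
    | add y z hy hz => simp only [map_add, hy, hz, mul_add]

theorem of_relExtend_relD {n : ℕ} (w : relPow φ n) :
    DirectSum.of Γ.Ω (n + 1) (relExtend f hf (n + 1) (relD φ n w)) =
      Γ.D (DirectSum.of Γ.Ω n (relExtend f hf n w)) := by
  induction n with
  | zero =>
    have of_relUnit (r : R) : DirectSum.of Γ.Ω 1 (relExtend f hf 1 (relD φ 0 (relUnit φ r))) =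
        Γ.D (DirectSum.of Γ.Ω 0 (f r)) := by
      rw [relD_relUnit, of_relExtend_relSnoc, relExtend_relUnit, map_one, DirectSum.of_zero_one,
        one_mul]
    exact of_relUnit w
  | succ n ih =>
    induction w using relPow_cases with
    | snoc w r =>
      rw [relD_relSnoc, of_relExtend_relSnoc, of_relExtend_relSnoc, Γ.D_mul, Γ.D_D_of, mul_zero,
        mul_zero, add_zero, ih]
    | add x y hx hy => simp only [map_add, hx, hy]

/-- The universal property of `Ω_S R`: a ring map `f : R → Γ⁰` under `S` extends to a homomorphism
of differential graded rings. -/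
def relFormsLift : RelDGRing.Hom (relForms φ) Γ where
  app := relExtend f hf
  map_mul _ _ x y := DirectSum.of_injective (β := Γ.Ω) _
    ((of_relExtend_relMul f hf x y).trans (DirectSum.of_mul_of _ _))
  map_one := map_one f
  map_d n w := DirectSum.of_injective (β := Γ.Ω) _
    ((of_relExtend_relD f hf w).trans (Γ.D_of n _))
  map_η := hf

end UniversalProperty

theorem tensMul_one_snoc_unitR {R : Type u} [Ring R] {M : Bimod.{u, u, u} R R} {n : ℕ}
    (x : tpow M n) (c : M) :
    tensMul n 1 x (snoc M 0 (unitR M 1) c) = snoc M n x c := by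
  rw [tensMul_snoc, tensMul_unitR, MulOpposite.op_one, one_smul]
  rfl

namespace Coring

variable {S : Type v} {R : Type u} [Ring S] [Ring R] {𝒞 : Coring R} {g : 𝒞.C}
  (hg : 𝒞.IsGrouplike g)

theorem projL_op_smul_grouplike (r : R) : projL hg (op r • g) = dZero hg r := by
  apply 𝒞.kerIncl_injective
  rw [kerIncl_projL, 𝒞.counit_op_smul, hg.counit, one_mul, dZero, kerIncl_kerMk]

theorem formsD_unitR (r : R) :
    formsD hg 0 (unitR 𝒞.kerCounit r) =
      snoc 𝒞.kerCounit 0 (unitR 𝒞.kerCounit 1) (dZero hg r) := by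
  apply incl_injective hg
  rw [incl_formsD]
  exact 𝒞.amitsur_unitR g r

variable (φ : S →+* R) (hφ : ∀ s, φ s • g = op (φ s) • g)

/-- The identification of `R` with the degree zero component of `Ω(C/S)`. -/
def formsUnit : R →+* (𝒞.forms φ g hg hφ).Ω 0 :=
  degZeroHom (A := (𝒞.forms φ g hg hφ).Ω) (unitR 𝒞.kerCounit) rfl fun _ _ => rfl

/-- The homomorphism `Ω_S R → Ω(C/S)` extending the identity of `R`. -/
def formsOfRel : RelDGRing.Hom (relForms φ) (𝒞.forms φ g hg hφ) :=
  relFormsLift (formsUnit hg φ hφ) fun _ => rfl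

theorem formsOfRel_relSnoc {n : ℕ} (w : relPow φ n) (r : R) :
    (formsOfRel hg φ hφ).app (n + 1) (relSnoc φ n w (proj φ r)) =
      snoc 𝒞.kerCounit n ((formsOfRel hg φ hφ).app n w) (dZero hg r) :=
  (congrArg (tensMul n 1 ((formsOfRel hg φ hφ).app n w)) (formsD_unitR hg r)).trans
    (tensMul_one_snoc_unitR _ _)

theorem formsOfRel_op_smul {n : ℕ} (s : S) (w : relPow φ n) :
    (formsOfRel hg φ hφ).app n (op s • w) =
      Bimod.rmul (tpow 𝒞.kerCounit n) ((formsOfRel hg φ hφ).app n w) (φ s) :=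
  DirectSum.of_injective (β := (𝒞.forms φ g hg hφ).Ω) n
    ((relExtend_op_smul (formsUnit hg φ hφ) (fun _ => rfl) w s).trans
      (DirectSum.of_mul_of _ _))

end Coring

section Sweedler

variable {S : Type v} {R : Type u} [Ring S] [Ring R] {φ : S →+* R}

theorem projL_rtmul (a b : R) :
    Coring.projL (sweedlerOne_isGrouplike φ) (rtmul φ a b) =
      a • Coring.dZero (sweedlerOne_isGrouplike φ) b := by
  rw [← Coring.projL_op_smul_grouplike, ← Coring.projL_left]
  congr 1
  change rtmul φ a b = a • op b • rtmul φ 1 1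
  rw [right_rtmul, left_rtmul, one_mul, mul_one]

theorem kerIncl_dZero (r : R) :
    (sweedler φ).kerIncl (Coring.dZero (sweedlerOne_isGrouplike φ) r) =
      rtmul φ 1 r - rtmul φ r 1 := by
  rw [Coring.dZero, Coring.kerIncl_kerMk]
  change op r • rtmul φ 1 1 - r • rtmul φ 1 1 = _
  rw [right_rtmul, left_rtmul, one_mul, mul_one]

variable {A B : Type*} [Ring A] [Ring B] {W : Bimod B S} {X : Bimod A R}
  (ψ : X →+ W) (hψ : ∀ (s : S) x, ψ (op (φ s) • x) = op s • ψ x)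

/-- The map `(x, a ⊗ b) ↦ ψ (x a) ⊗ π(b)`, balanced over `R` in `x` and the tensor `a ⊗ b`. -/
def sweedlerContract : X →+ sweedlerBimod φ →+ Bimod.tensor W (cokerBimod φ) :=
  AddMonoidHom.mk'
    (fun x => rlift
      (((Bimod.tmul W (cokerBimod φ)).compl₂ (proj φ)).comp (ψ.comp (Bimod.rmul X x)))
      fun a s b => by
        change Bimod.tmul W _ (ψ (op (a * φ s) • x)) (proj φ b) =
          Bimod.tmul W _ (ψ (op a • x)) (proj φ (φ s * b))
        rw [← Bimod.op_op_smul, hψ, Bimod.tmul_smul, proj_left])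
    fun x y => Bimod.tensor_ext (X := resRight φ) (Y := resLeft φ) fun (a b : R) => by
      change Bimod.tmul W _ (ψ (op a • (x + y))) (proj φ b) =
        Bimod.tmul W _ (ψ (op a • x)) (proj φ b) + Bimod.tmul W _ (ψ (op a • y)) (proj φ b)
      rw [smul_add, map_add, map_add, AddMonoidHom.add_apply]

theorem sweedlerContract_rtmul (x : X) (a b : R) :
    sweedlerContract ψ hψ x (rtmul φ a b) =
      Bimod.tmul W (cokerBimod φ) (ψ (op a • x)) (proj φ b) := rfl

theorem sweedlerContract_op_smul (x : X) (r : R) (c : sweedlerBimod φ) :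
    sweedlerContract ψ hψ (op r • x) c = sweedlerContract ψ hψ x (r • c) := by
  induction c using sweedler_induction with
  | tmul a b =>
    rw [left_rtmul, sweedlerContract_rtmul, sweedlerContract_rtmul, Bimod.op_op_smul]
  | add c c' hc hc' => rw [smul_add, map_add, map_add, hc, hc']

/-- The restriction `x ⊗ k ↦ ∑ ψ (x aᵢ) ⊗ π(bᵢ)`, for `k = ∑ aᵢ ⊗ bᵢ`, of `sweedlerContract` to the
kernel of the counit. -/
def kerContract : Bimod.tensor X (sweedler φ).kerCounit →+ Bimod.tensor W (cokerBimod φ) :=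
  Bimod.lift ((sweedlerContract ψ hψ).compl₂ (sweedler φ).kerIncl.toAddMonoidHom) fun x r k =>
    (sweedlerContract_op_smul ψ hψ x r _).trans
      (congrArg (sweedlerContract ψ hψ x) ((sweedler φ).kerIncl.left r k).symm)

theorem kerContract_tmul (x : X) (k : (sweedler φ).kerCounit) :
    kerContract ψ hψ (Bimod.tmul X (sweedler φ).kerCounit x k) =
      sweedlerContract ψ hψ x ((sweedler φ).kerIncl k) := rfl

theorem kerContract_tmul_dZero (x : X) (r : R) :
    kerContract ψ hψ (Bimod.tmul X (sweedler φ).kerCounit x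
        (Coring.dZero (sweedlerOne_isGrouplike φ) r)) =
      Bimod.tmul W (cokerBimod φ) (ψ x) (proj φ r) := by
  rw [kerContract_tmul, kerIncl_dZero, map_sub, sweedlerContract_rtmul, sweedlerContract_rtmul,
    proj_one, map_zero, sub_zero, MulOpposite.op_one, one_smul]

variable {F : Bimod.tensor W (cokerBimod φ) →+ Bimod.tensor X (sweedler φ).kerCounit}
  {e : W →+ X} (hF : ∀ w r, F (Bimod.tmul W (cokerBimod φ) w (proj φ r)) =
    Bimod.tmul X (sweedler φ).kerCounit (e w) (Coring.dZero (sweedlerOne_isGrouplike φ) r))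

include hF

theorem map_sweedlerContract (heψ : Function.RightInverse ψ e) (x : X) (c : sweedlerBimod φ) :
    F (sweedlerContract ψ hψ x c) =
      Bimod.tmul X (sweedler φ).kerCounit x (Coring.projL (sweedlerOne_isGrouplike φ) c) := by
  induction c using sweedler_induction with
  | tmul a b =>
    rw [sweedlerContract_rtmul, hF, heψ, Bimod.tmul_smul]
    exact congrArg _ (projL_rtmul a b).symm
  | add c c' hc hc' =>
    rw [map_add, map_add, hc, hc', ← map_add]
    exact congrArg _ (map_add _ c c').symm

theorem kerContract_leftInverse (heψ : Function.LeftInverse ψ e) :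
    Function.LeftInverse (kerContract ψ hψ) F := by
  intro z
  induction z using Bimod.tensor_induction with
  | tmul w q =>
    obtain ⟨r, rfl⟩ := proj_surjective φ q
    rw [hF, kerContract_tmul_dZero, heψ]
  | add x y hx hy => rw [map_add, map_add, hx, hy]

theorem kerContract_rightInverse (heψ : Function.RightInverse ψ e) :
    Function.RightInverse (kerContract ψ hψ) F := by
  intro z
  induction z using Bimod.tensor_induction with
  | tmul x k =>
    rw [kerContract_tmul]
    exact (map_sweedlerContract ψ hψ hF heψ x _).trans
      (congrArg _ (Coring.projL_kerIncl (sweedlerOne_isGrouplike φ) k))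
  | add x y hx hy => rw [map_add, map_add, hx, hy]

theorem bijective_of_tmul_proj_eq_tmul_dZero (he : Function.Bijective e)
    (he_smul : ∀ (s : S) w, e (op s • w) = op (φ s) • e w) : Function.Bijective F := by
  let e' := AddEquiv.ofBijective e he
  have he_symm (s : S) (x : X) : e'.symm (op (φ s) • x) = op s • e'.symm x := by
    rw [AddEquiv.symm_apply_eq, AddEquiv.ofBijective_apply, he_smul]
    exact congrArg _ (e'.apply_symm_apply x).symm
  exact ⟨(kerContract_leftInverse (e'.symm : X →+ W) he_symm hF e'.symm_apply_apply).injective,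
    (kerContract_rightInverse (e'.symm : X →+ W) he_symm hF e'.apply_symm_apply).surjective⟩

end Sweedler

section SweedlerForms

variable {S : Type v} {R : Type u} [Ring S] [Ring R] (φ : S →+* R)

/-- The homomorphism `Ω_S R → Ω(C/S)` for the Sweedler coring `C = R ⊗_S R`. -/
def sweedlerFormsOfRel : RelDGRing.Hom (relForms φ) (sweedlerForms φ) :=
  Coring.formsOfRel (sweedlerOne_isGrouplike φ) φ (sweedlerOne_central φ)

theorem sweedlerFormsOfRel_bijective (n : ℕ) :
    Function.Bijective ((sweedlerFormsOfRel φ).app n) := by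
  induction n with
  | zero => exact Function.bijective_id
  | succ n ih =>
    exact bijective_of_tmul_proj_eq_tmul_dZero (W := relPow φ n)
      (X := tpow (sweedler φ).kerCounit n) (Coring.formsOfRel_relSnoc _ φ _) ih
      (Coring.formsOfRel_op_smul _ φ _)

/-- The isomorphism `Ω(C/S) ≅ Ω_S R` for the Sweedler coring `C = R ⊗_S R`. -/
def sweedlerFormsIso : RelDGRing.Iso (sweedlerForms φ) (relForms φ) :=
  ((sweedlerFormsOfRel φ).isoOfBijective (sweedlerFormsOfRel_bijective φ)).symm

end SweedlerForms

end CoringForms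

end

theorem mainTheorem5 {S R : Type*} [Ring S] [Ring R] (φ : S →+* R) :
    Nonempty (CoringForms.RelDGRing.Iso
      (CoringForms.sweedlerForms φ) (CoringForms.relForms φ)) :=
  ⟨CoringForms.sweedlerFormsIso φ⟩
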